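/- Let $F=\mathbb F_q$ be a finite field, $K$ a field, $n\ge 0$, and let $\mathcal C\subseteq F^n$ be a linear code of dimension $k\ge 1$. **Codes.** For $c\in F^n$ let $\operatorname{supp}(c)=\{i: c_i\ne 0\}$; for a subspace $D\subseteq F^n$ let $w(D)$ be the number of coordinates at which some element of $D$ is nonzero. For $1\le r\le k$ let $d_r(\mathcal C)=\min\{w(D): D\subseteq\mathcal C \text{ a subspace},\ \dim D=r\}$. A nonzero codeword has *minimal support* if no nonzero codeword has a support properly contained in its support. **The ideal $I(\mathcal C)$.** Consider the polynomial ring $K[\mathbf x]$ in the indeterminates $x_{i,\gamma}$ with $1\le i\le n$ and $\gamma\in F\setminus\{0\}$. For $a\in F^n$ put $\mathbf x^{\Delta a}=\prod_{i:\,a_i\neq 0}x_{i,a_i}$, and let $$I(\mathcal C)=\langle \mathbf x^{\Delta a}-\mathbf x^{\Delta b} : a-b\in\mathcal C\rangle .$$ Let $\mathcal R$ be the ideal generated by all $x_{i,\gamma}x_{i,\delta}-x_{i,\gamma+\delta}$ with $\gamma+\delta\ne0$ and all $x_{i,\gamma}x_{i,-\gamma}-1$. Fix a monomial order $\prec$ on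 $K[\mathbf x]$ that is degree compatible (monomials of smaller total degree are smaller) and satisfies $x_{i',\gamma'}\prec x_{i,\gamma}$ whenever $i<i'$. Order $F^n$ by $a\prec b\iff \mathbf x^{\Delta a}\prec\mathbf x^{\Delta b}$. Let $\mathcal G$ be the reduced Gröbner basis of $I(\mathcal C)$ with respect to $\prec$, and let $M_{\mathcal G}$ be the set of codewords of minimal support of the form $a-b$, where $\mathbf x^{\Delta a}-\mathbf x^{\Delta b}\in\mathcal G\setminus\mathcal R$ and $\mathbf x^{\Delta b}\prec\mathbf x^{\Delta a}$. **Betti numbers.** Let $R=K[x_1,\dots,x_n]$ with the standard grading and $I_{M_{\mathcal G}}=\langle \prod_{i\in\operatorname{supp}(c)}x_i : c\in M_{\mathcal G}\rangle\subseteq R$. Then $R/I_{M_{\mathcal G}}$ has a minimal graded free resolution; for any such resolution $\cdots\to F_1\to F_0\to R/I_{M_{\mathcal G}}\to0$ write $F_i=\bigoplus_j R(-j)^{\beta_{i,j}}$. The following hold. 1. $d_1(\mathcal C)=\min\{j:\beta_{1,j}(R/I_{M_{\mathcal G}})\neq 0\}$. 2. Suppose that $k\ge2$ and that $\prec$ also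 satisfies: if $a,b\in F^n$ have disjoint supports and $\mathbf x^{\Delta b}\prec\mathbf x^{\Delta a}$, then $\mathbf x^{\Delta(-b)}\prec\mathbf x^{\Delta(-a)}$. Let $m_1$ be the $\prec$-least element of $\{m\in\mathcal C\setminus\{0\}: \exists\, m'\in\mathcal C,\ w(\langle m,m'\rangle)=d_2(\mathcal C)\}$, let $m_2$ be the $\prec$-least element of $\{m\in\mathcal C: w(\langle m_1,m\rangle)=d_2(\mathcal C)\}$, and put $\mathcal I=\operatorname{supp}(m_1)$, $\mathcal J=\operatorname{supp}(m_2)$. If $|\mathcal I\cap \mathcal J|\le\frac{|\mathcal J|+1}{2}$, then $d_2(\mathcal C)=\min\{j:\beta_{2,j}(R/I_{M_{\mathcal G}})\ne0\}$. In particular both minima are over nonempty sets. -/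

import Mathlib

open scoped MonomialOrder

noncomputable section

namespace LinearCodeBetti

/-! ### Linear codes and generalized Hamming weights -/

section Codes

variable {F : Type*} [Field F] {n : ℕ}

/-- The support of a word, as a finite set of coordinates. -/
def supp (c : Fin n → F) : Finset (Fin n) :=
  (Set.toFinite {i | c i ≠ 0}).toFinset

/-- The support of a subspace `D`: the coordinates at which some element of `D` is nonzero. -/
def suppSub (D : Submodule F (Fin n → F)) : Finset (Fin n) :=
  (Set.toFinite {i | ∃ c ∈ D, i ∈ supp c}).toFinset

/-- The `r`-th generalized Hamming weight: the least weight of an `r`-dimensional subspace of `C`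
(meaningful for `1 ≤ r ≤ dim C`). -/
def ghw (C : Submodule F (Fin n → F)) (r : ℕ) : ℕ :=
  sInf {w | ∃ D : Submodule F (Fin n → F), D ≤ C ∧ Module.finrank F D = r ∧
    (suppSub D).card = w}

/-- The set of codewords of minimal support. -/
def minSupportWords (C : Submodule F (Fin n → F)) : Set (Fin n → F) :=
  {c | c ∈ C ∧ c ≠ 0 ∧ ∀ c' ∈ C, c' ≠ 0 → ¬ supp c' ⊂ supp c}

end Codes

/-! ### The binomial ideal of a code

The indeterminates over the `i`-th coordinate are indexed by the nonzero elements of `F`: once a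
primitive element `α` is fixed, the indeterminate `x_{i,j}` is `X (i, α ^ j)`. -/

section BinomialIdeal

variable {F : Type*} [Field F] [Finite F] {n : ℕ}

open Classical in
/-- The exponent vector `Δ a`: its block at coordinate `i` is the unit vector of `a i` if
`a i ≠ 0`, and zero otherwise. -/
def expo (a : Fin n → F) : Fin n × Fˣ →₀ ℕ :=
  Finsupp.equivFunOnFinite.symm fun p => if a p.1 = (p.2 : F) then 1 else 0

variable (K : Type*) [Field K]

/-- The monomial `x ^ Δ a`. -/
def wordMonomial (a : Fin n → F) : MvPolynomial (Fin n × Fˣ) K :=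
  MvPolynomial.monomial (expo a) 1

/-- The ideal generated by all `x ^ Δ a - x ^ Δ b` with `a - b ∈ C`. -/
def codeIdeal (C : Submodule F (Fin n → F)) : Ideal (MvPolynomial (Fin n × Fˣ) K) :=
  Ideal.span {f | ∃ a b : Fin n → F, a - b ∈ C ∧ f = wordMonomial K a - wordMonomial K b}

variable (F n) in
/-- The sum over all coordinates `i` of the ideals encoding the addition table of `F` in the
indeterminates of the `i`-th block. -/
def additionIdeal : Ideal (MvPolynomial (Fin n × Fˣ) K) :=
  ⨆ i : Fin n,
    (Ideal.span {f | ∃ u v w : Fˣ, (u : F) + v = w ∧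
        f = MvPolynomial.X (i, u) * MvPolynomial.X (i, v) - MvPolynomial.X (i, w)} ⊔
      Ideal.span {f | ∃ u v : Fˣ, (u : F) + v = 0 ∧
        f = MvPolynomial.X (i, u) * MvPolynomial.X (i, v) - 1})

end BinomialIdeal

/-! ### Gröbner bases -/

section Groebner

variable {σ K : Type*} [Field K]

/-- The initial ideal, generated by the initial monomials of the nonzero elements of `I`. -/
def initialIdeal (ord : MonomialOrder σ) (I : Ideal (MvPolynomial σ K)) :
    Ideal (MvPolynomial σ K) :=
  Ideal.span {t | ∃ f ∈ I, f ≠ 0 ∧ t = MvPolynomial.monomial (ord.degree f) 1}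

/-- `G` is the reduced Gröbner basis of `I`. -/
structure IsReducedGroebnerBasis (ord : MonomialOrder σ) (I : Ideal (MvPolynomial σ K))
    (G : Set (MvPolynomial σ K)) : Prop where
  finite : G.Finite
  subset : G ⊆ I
  span_initial :
    initialIdeal ord I = Ideal.span {t | ∃ g ∈ G, t = MvPolynomial.monomial (ord.degree g) 1}
  monic : ∀ g ∈ G, ord.Monic g
  reduced : ∀ g ∈ G, ∀ g' ∈ G, g ≠ g' → ∀ s ∈ g'.support, ¬ ord.degree g ≤ s

/-- The order refines the total degree. -/
def DegreeCompatible (ord : MonomialOrder σ) : Prop :=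
  ∀ s t : σ →₀ ℕ, s.degree < t.degree → s ≺[ord] t

end Groebner

section GroebnerWords

variable {F : Type*} [Field F] [Finite F] {n : ℕ}

/-- `X_n ≺ ⋯ ≺ X_1`: every indeterminate of a later block is smaller than every indeterminate of
an earlier block. -/
def BlockDecreasing (ord : MonomialOrder (Fin n × Fˣ)) : Prop :=
  ∀ i i' : Fin n, i < i' → ∀ u u' : Fˣ,
    (Finsupp.single (i', u') 1 : Fin n × Fˣ →₀ ℕ) ≺[ord] Finsupp.single (i, u) 1

/-- For words with disjoint supports, `x ^ Δ b ≺ x ^ Δ a` implies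
`x ^ Δ (-b) ≺ x ^ Δ (-a)`. -/
def NegCompatible (ord : MonomialOrder (Fin n × Fˣ)) : Prop :=
  ∀ a b : Fin n → F, Disjoint (supp a) (supp b) →
    expo b ≺[ord] expo a → expo (-b) ≺[ord] expo (-a)

/-- `m` is the least element of `S` for the order on words `a ≺ b ↔ x ^ Δ a ≺ x ^ Δ b`. -/
def IsLeastWord (ord : MonomialOrder (Fin n × Fˣ)) (S : Set (Fin n → F)) (m : Fin n → F) : Prop :=
  m ∈ S ∧ ∀ m' ∈ S, expo m ≼[ord] expo m'

/-- The set `M_G`: codewords of minimal support of the form `c_g = a - b` for some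
`g = x ^ Δ a - x ^ Δ b ∈ G` outside the addition ideal, where `x ^ Δ b ≺ x ^ Δ a`. -/
def groebnerWords {K : Type*} [Field K] (ord : MonomialOrder (Fin n × Fˣ))
    (C : Submodule F (Fin n → F)) (G : Set (MvPolynomial (Fin n × Fˣ) K)) : Set (Fin n → F) :=
  {c | c ∈ C ∧ ∃ a b : Fin n → F,
      wordMonomial K a - wordMonomial K b ∈ G ∧
      wordMonomial K a - wordMonomial K b ∉ additionIdeal F n K ∧
      expo b ≺[ord] expo a ∧ a - b = c} ∩ minSupportWords C

/-- The nonzero codewords `m` such that `⟨m, m'⟩` has weight `d_2(C)` for some codeword `m'`. -/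
def firstWords (C : Submodule F (Fin n → F)) : Set (Fin n → F) :=
  {m | m ∈ C ∧ m ≠ 0 ∧ ∃ m' ∈ C, ghw C 2 = (suppSub (Submodule.span F {m, m'})).card}

/-- The codewords `m` such that `⟨m₁, m⟩` has weight `d_2(C)`. -/
def secondWords (C : Submodule F (Fin n → F)) (m₁ : Fin n → F) : Set (Fin n → F) :=
  {m | m ∈ C ∧ ghw C 2 = (suppSub (Submodule.span F {m₁, m})).card}

end GroebnerWords

/-! ### Monomial ideals and graded Betti numbers -/

section Betti

variable {n : ℕ}

/-- The square-free monomial ideal of `K[x_1, …, x_n]` generated by the monomials `x ^ supp c`,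
`c ∈ M`. -/
def supportIdeal {F : Type*} [Field F] (K : Type*) [Field K] (M : Set (Fin n → F)) :
    Ideal (MvPolynomial (Fin n) K) :=
  Ideal.span {t | ∃ c ∈ M, t = ∏ i ∈ supp c, MvPolynomial.X i}

/-- A minimal graded free resolution `⋯ → F_2 → F_1 → F_0 → R / I → 0` over `R = K[x_1, …, x_n]`.
The module `F_i` is free on a finite basis, whose `k`-th element has degree `deg i k`, that is
`F_i = ⨁ₖ R(-deg i k)`; all maps are homogeneous of degree `0`, the sequence is exact, and
`d i : F_{i+1} → F_i` has its image in `(x_1, …, x_n) F_i`. -/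
structure MinimalGradedFreeResolution {K : Type*} [Field K]
    (I : Ideal (MvPolynomial (Fin n) K)) where
  rank : ℕ → ℕ
  deg : (i : ℕ) → Fin (rank i) → ℕ
  d : (i : ℕ) → (Fin (rank (i + 1)) → MvPolynomial (Fin n) K) →ₗ[MvPolynomial (Fin n) K]
    (Fin (rank i) → MvPolynomial (Fin n) K)
  aug : (Fin (rank 0) → MvPolynomial (Fin n) K) →ₗ[MvPolynomial (Fin n) K]
    (MvPolynomial (Fin n) K ⧸ I)
  d_homogeneous : ∀ i k l, ∀ s ∈ (d i (Pi.single k 1) l).support,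
    s.degree + deg i l = deg (i + 1) k
  aug_homogeneous : ∀ k, ∃ p : MvPolynomial (Fin n) K,
    p.IsHomogeneous (deg 0 k) ∧ aug (Pi.single k 1) = Ideal.Quotient.mk I p
  exact : ∀ i, Function.Exact (d (i + 1)) (d i)
  exact_aug : Function.Exact (d 0) aug
  aug_surjective : Function.Surjective aug
  minimal : ∀ i k l, MvPolynomial.constantCoeff (d i (Pi.single k 1) l) = 0

/-- The graded Betti number `β_{i,j}`: the number of summands `R(-j)` of `F_i`. -/
def MinimalGradedFreeResolution.betti {K : Type*} [Field K]
    {I : Ideal (MvPolynomial (Fin n) K)} (P : MinimalGradedFreeResolution I) (i j : ℕ) : ℕ :=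
  (Finset.univ.filter fun k => P.deg i k = j).card

end Betti

end LinearCodeBetti

end

open LinearCodeBetti

/-! Both Betti numbers are read off from the generators. Elements of `groebnerWords` are nonzero
codewords, so every generator has degree at least `d₁`; two of them with distinct supports are
linearly independent, so the lcm of two distinct generators has degree at least `d₂`. Supports are
minimal, so the generators form an antichain. For such a monomial ideal `isLeast_betti_one` and
`isLeast_betti_two` find the least degrees in `F_1` and `F_2`: the least degree of a generator and
the least degree of a pairwise lcm. It remains to attain `d₁` and `d₂` inside `groebnerWords`.

The link to Gröbner bases is the group algebra of `Fⁿ / C`. The code ideal vanishes there, so the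
monomial of a word that is least in its coset is never a leading monomial. Hence if `a` is not least
in its coset but every word obtained by erasing one entry is, the reduced basis contains `x ^ Δ a -
x ^ Δ b'`, where `b'` is the least word of the coset of `a` (`exists_sub_mem_groebner`).

To use this, split a codeword as `a - b` with disjoint supports whose sizes differ by at most one.
If erasing an entry of the larger word did not give a coset-least word, a codeword lighter than the
split one would appear. At minimum weight this is absurd at once. For `d₂`, the choice of `m₁`
yields an element with the support of `m₁` (`exists_mem_groebnerWords_supp_eq`). The bound on the
intersection lets `m₂` be split with `b` avoiding the support of `m₁`; among all such pairs one with
least `expo a + expo b` is taken, and exchange arguments give the second generator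
(`exists_mem_groebnerWords_card_union_eq`). -/

namespace LinearCodeBetti

noncomputable section

/-! ### Supports and generalized Hamming weights -/

section Codes

variable {F : Type*} [Field F] {n : ℕ}

@[simp]
lemma mem_supp {c : Fin n → F} {i : Fin n} : i ∈ supp c ↔ c i ≠ 0 := by
  simp [supp]

lemma supp_add_subset (a b : Fin n → F) : supp (a + b) ⊆ supp a ∪ supp b := by
  intro i
  simp only [mem_supp, Finset.mem_union, Pi.add_apply]
  contrapose!
  rintro ⟨h, h'⟩
  simp [h, h']

@[simp]
lemma supp_neg (a : Fin n → F) : supp (-a) = supp a := by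
  ext i
  simp

lemma supp_sub_subset (a b : Fin n → F) : supp (a - b) ⊆ supp a ∪ supp b := by
  simpa [sub_eq_add_neg] using supp_add_subset a (-b)

lemma supp_smul {t : F} (ht : t ≠ 0) (a : Fin n → F) : supp (t • a) = supp a := by
  ext i
  simp [ht]

lemma supp_smul_subset (t : F) (a : Fin n → F) : supp (t • a) ⊆ supp a := by
  intro i
  simp only [mem_supp, Pi.smul_apply, smul_eq_mul]
  exact right_ne_zero_of_mul

lemma supp_nonempty {a : Fin n → F} (ha : a ≠ 0) : (supp a).Nonempty := by
  obtain ⟨i, hi⟩ := Function.ne_iff.mp ha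
  exact ⟨i, mem_supp.mpr hi⟩

@[simp]
lemma supp_zero : supp (0 : Fin n → F) = ∅ := by
  ext i
  simp

lemma supp_single {i : Fin n} {t : F} (ht : t ≠ 0) : supp (Pi.single i t) = {i} := by
  ext j
  by_cases h : j = i
  · subst h; simp [ht]
  · simp [h]

/-- The word `a` with its `i`-th entry replaced by zero. -/
abbrev erase (a : Fin n → F) (i : Fin n) : Fin n → F := Function.update a i 0

lemma supp_erase (a : Fin n → F) (i : Fin n) : supp (erase a i) = (supp a).erase i := by
  ext j
  by_cases h : j = i
  · subst h; simp
  · simp [h]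

lemma single_add_erase (a : Fin n → F) (i : Fin n) : Pi.single i (a i) + erase a i = a := by
  ext j
  by_cases h : j = i
  · subst h; simp
  · simp [h]

lemma disjoint_single_erase (a : Fin n → F) (i : Fin n) :
    Disjoint (supp (Pi.single i (a i))) (supp (erase a i)) := by
  rw [Finset.disjoint_left]
  intro j hj
  by_cases h : j = i
  · subst h; simp
  · simp [h] at hj

open Classical in
/-- A word splits along any set of coordinates as a difference of two words. -/
lemma exists_split (m : Fin n → F) {T : Finset (Fin n)} (hT : T ⊆ supp m) :
    ∃ a b : Fin n → F, m = a - b ∧ supp a = T ∧ supp b = supp m \ T := by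
  refine ⟨fun i => if i ∈ T then m i else 0, fun i => if i ∈ T then 0 else -m i, ?_, ?_, ?_⟩
  · ext i
    by_cases h : i ∈ T <;> simp [h]
  · ext i
    by_cases h : i ∈ T
    · simpa [h] using hT h
    · simp [h]
  · ext i
    by_cases h : i ∈ T <;> simp [h]

lemma suppSub_span_pair (x y : Fin n → F) :
    suppSub (Submodule.span F {x, y}) = supp x ∪ supp y := by
  ext i
  simp only [suppSub, Set.Finite.mem_toFinset, Set.mem_ofPred_eq, Finset.mem_union]
  constructor
  · rintro ⟨c, hc, hi⟩
    obtain ⟨s, t, rfl⟩ := Submodule.mem_span_pair.mp hc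
    rcases Finset.mem_union.mp (supp_add_subset _ _ hi) with h | h
    · exact Or.inl (supp_smul_subset _ _ h)
    · exact Or.inr (supp_smul_subset _ _ h)
  · rintro (h | h)
    · exact ⟨x, Submodule.subset_span (by simp), h⟩
    · exact ⟨y, Submodule.subset_span (by simp), h⟩

lemma suppSub_span_singleton (x : Fin n → F) : suppSub (Submodule.span F {x}) = supp x := by
  simpa using suppSub_span_pair x x

variable {C : Submodule F (Fin n → F)}

lemma ghw_one_le {c : Fin n → F} (hc : c ∈ C) (h0 : c ≠ 0) : ghw C 1 ≤ (supp c).card :=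
  Nat.sInf_le ⟨Submodule.span F {c}, by simpa using hc, finrank_span_singleton h0,
    by rw [suppSub_span_singleton]⟩

lemma exists_card_supp_eq_ghw_one (hC : 1 ≤ Module.finrank F C) :
    ∃ c ∈ C, c ≠ 0 ∧ (supp c).card = ghw C 1 := by
  have hne : {w | ∃ D : Submodule F (Fin n → F), D ≤ C ∧ Module.finrank F D = 1 ∧
      (suppSub D).card = w}.Nonempty := by
    have hC' : C ≠ ⊥ := by
      rintro rfl
      simp at hC
    obtain ⟨c, hc, h0⟩ := Submodule.exists_mem_ne_zero_of_ne_bot hC'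
    exact ⟨_, Submodule.span F {c}, by simpa using hc, finrank_span_singleton h0, rfl⟩
  obtain ⟨D, hD, h1, hw⟩ := Nat.sInf_mem hne
  obtain ⟨⟨c, hc⟩, h0, -⟩ := finrank_eq_one_iff'.mp h1
  have h0' : c ≠ 0 := fun h => h0 (Subtype.ext h)
  refine ⟨c, hD hc, h0', ?_⟩
  have : Submodule.span F {c} = D :=
    Submodule.eq_of_le_of_finrank_eq (by simpa using hc) (by rw [finrank_span_singleton h0', h1])
  rw [← suppSub_span_singleton, this]
  exact hw

lemma finrank_span_pair {x y : Fin n → F} (hx : x ≠ 0) (hy : ∀ t : F, t • x ≠ y) :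
    Module.finrank F (Submodule.span F {x, y}) = 2 := by
  have h : LinearIndependent F ![x, y] :=
    (LinearIndependent.pair_iff' hx).mpr hy
  have := finrank_span_eq_card h
  rwa [Matrix.range_cons, Matrix.range_cons, Matrix.range_empty, Set.union_empty,
    Set.singleton_union, Fintype.card_fin] at this

lemma ghw_two_le {x y : Fin n → F} (hxC : x ∈ C) (hyC : y ∈ C) (hx : x ≠ 0)
    (hy : ∀ t : F, t • x ≠ y) : ghw C 2 ≤ (supp x ∪ supp y).card :=
  Nat.sInf_le ⟨Submodule.span F {x, y}, Submodule.span_le.mpr (by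
    rintro z (rfl | rfl) <;> assumption), finrank_span_pair hx hy, by rw [suppSub_span_pair]⟩

lemma exists_card_supp_eq_ghw_two (hC : 2 ≤ Module.finrank F C) :
    ∃ x ∈ C, ∃ y ∈ C, x ≠ 0 ∧ (∀ t : F, t • x ≠ y) ∧ (supp x ∪ supp y).card = ghw C 2 := by
  have key : ∀ D : Submodule F (Fin n → F), Module.finrank F D = 2 →
      ∃ x y : Fin n → F, x ≠ 0 ∧ (∀ t : F, t • x ≠ y) ∧ D = Submodule.span F {x, y} := by
    intro D hD
    let b := Module.finBasisOfFinrankEq F D hD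
    have hli : LinearIndependent F ![(b 0 : Fin n → F), b 1] := by
      have := b.linearIndependent.map' D.subtype (Submodule.ker_subtype D)
      have he : ![(b 0 : Fin n → F), b 1] = D.subtype ∘ b := by
        ext i : 1
        fin_cases i <;> rfl
      rwa [he]
    have h0 : (b 0 : Fin n → F) ≠ 0 := hli.ne_zero 0
    refine ⟨b 0, b 1, h0, (LinearIndependent.pair_iff' h0).mp hli, ?_⟩
    refine (Submodule.eq_of_le_of_finrank_eq ?_ ?_).symm
    · exact Submodule.span_le.mpr (by rintro z (rfl | rfl) <;> exact Subtype.property _)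
    · rw [hD, finrank_span_pair h0 ((LinearIndependent.pair_iff' h0).mp hli)]
  have hne : {w | ∃ D : Submodule F (Fin n → F), D ≤ C ∧ Module.finrank F D = 2 ∧
      (suppSub D).card = w}.Nonempty := by
    obtain ⟨f, hf⟩ := exists_linearIndependent_of_le_finrank (R := F) hC
    have hf' := hf.map' C.subtype (Submodule.ker_subtype C)
    refine ⟨_, Submodule.span F (Set.range (C.subtype ∘ f)), Submodule.span_le.mpr ?_, ?_, rfl⟩
    · rintro z ⟨i, rfl⟩
      exact Subtype.property _
    · simpa using finrank_span_eq_card hf'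
  obtain ⟨D, hD, h2, hw⟩ := Nat.sInf_mem hne
  obtain ⟨x, y, hx, hy, rfl⟩ := key D h2
  exact ⟨x, hD (Submodule.subset_span (by simp)), y, hD (Submodule.subset_span (by simp)), hx, hy,
    by rw [← suppSub_span_pair]; exact hw⟩

lemma mem_minSupportWords_of_card_le_ghw_one {c : Fin n → F} (hc : c ∈ C) (h0 : c ≠ 0)
    (h : (supp c).card ≤ ghw C 1) : c ∈ minSupportWords C :=
  ⟨hc, h0, fun _ hc' h0' hlt =>
    (Finset.card_lt_card hlt).not_ge (h.trans (ghw_one_le hc' h0'))⟩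

/-- A nonzero codeword supported strictly inside `supp c` is not a multiple of `c`, so the two would
span a plane of weight `(supp c).card`, which is below `d₂`. -/
lemma mem_minSupportWords_of_card_lt_ghw_two {c : Fin n → F} (hc : c ∈ C) (h0 : c ≠ 0)
    (h : (supp c).card < ghw C 2) : c ∈ minSupportWords C := by
  refine ⟨hc, h0, fun c' hc' h0' hlt => ?_⟩
  by_cases hp : ∃ t : F, t • c = c'
  · obtain ⟨t, rfl⟩ := hp
    have ht : t ≠ 0 := by
      rintro rfl
      simp at h0'
    rw [supp_smul ht] at hlt
    exact hlt.ne rfl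
  · push Not at hp
    have := ghw_two_le hc hc' h0 hp
    rw [Finset.union_eq_left.mpr hlt.subset] at this
    omega

/-- Induction on words, adding one nonzero entry at a time. -/
lemma word_induction {P : (Fin n → F) → Prop} (h0 : P 0)
    (hs : ∀ (a : Fin n → F) (i : Fin n), a i ≠ 0 → P (erase a i) → P a) (a : Fin n → F) : P a := by
  induction h : (supp a).card generalizing a with
  | zero =>
    have : a = 0 := by
      by_contra ha
      exact (supp_nonempty ha).card_pos.ne' h
    exact this ▸ h0
  | succ k ih =>
    obtain ⟨i, hi⟩ := Finset.card_pos.mp (h.symm ▸ k.succ_pos : 0 < (supp a).card)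
    refine hs a i (mem_supp.mp hi) (ih _ ?_)
    rw [supp_erase, Finset.card_erase_of_mem hi, h, Nat.add_sub_cancel]

variable (F n) in
/-- The word `∑ s (i, u) • u eᵢ` represented by an exponent vector `s`. -/
def word : (Fin n × Fˣ →₀ ℕ) →+ (Fin n → F) :=
  Finsupp.liftAddHom fun p => multiplesHom (Fin n → F) (Pi.single p.1 (p.2 : F))

@[simp]
lemma word_single (p : Fin n × Fˣ) (k : ℕ) :
    word F n (Finsupp.single p k) = k • Pi.single p.1 (p.2 : F) := by
  simp [word]

end Codes

/-! ### Exponent vectors of words -/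

section Expo

variable {F : Type*} [Field F] [Finite F] {n : ℕ}

open Classical in
lemma expo_apply (a : Fin n → F) (p : Fin n × Fˣ) :
    expo a p = if a p.1 = (p.2 : F) then 1 else 0 := rfl

lemma expo_add_of_disjoint {a b : Fin n → F} (h : Disjoint (supp a) (supp b)) :
    expo (a + b) = expo a + expo b := by
  ext ⟨i, u⟩
  have hi : a i = 0 ∨ b i = 0 := by
    by_contra! hc
    exact Finset.disjoint_left.mp h (mem_supp.mpr hc.1) (mem_supp.mpr hc.2)
  rcases hi with hi | hi
  · have h' : (a + b) i = b i := by simp [hi]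
    simp only [Finsupp.add_apply, expo_apply]
    rw [h', hi, if_neg u.ne_zero.symm, zero_add]
  · have h' : (a + b) i = a i := by simp [hi]
    simp only [Finsupp.add_apply, expo_apply]
    rw [h', hi, if_neg u.ne_zero.symm, add_zero]

@[simp]
lemma expo_zero : expo (0 : Fin n → F) = 0 := by
  ext ⟨i, u⟩
  simp [expo_apply, u.ne_zero.symm]

lemma expo_single (i : Fin n) (u : Fˣ) :
    expo (Pi.single i (u : F)) = Finsupp.single (i, u) 1 := by
  ext ⟨j, v⟩
  by_cases h : j = i
  · subst h
    by_cases huv : u = v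
    · subst huv; simp [expo_apply]
    · have : (j, u) ≠ (j, v) := by simpa using huv
      simpa [expo_apply, Finsupp.single_eq_of_ne this.symm] using fun h => huv (Units.ext h)
  · have : (j, v) ≠ (i, u) := by simp [h]
    simp [expo_apply, h, v.ne_zero.symm, Finsupp.single_eq_of_ne this]

lemma expo_eq_single_add_expo_erase {a : Fin n → F} {i : Fin n} (hi : a i ≠ 0) :
    expo a = Finsupp.single (i, Units.mk0 _ hi) 1 + expo (erase a i) := by
  conv_lhs => rw [← single_add_erase a i]
  rw [expo_add_of_disjoint (disjoint_single_erase a i), ← expo_single, Units.val_mk0]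

@[simp]
lemma degree_expo (a : Fin n → F) : (expo a).degree = (supp a).card := by
  induction a using word_induction with
  | h0 => simp
  | hs a i hi ih =>
    rw [expo_eq_single_add_expo_erase hi, map_add, ih, Finsupp.degree_single, supp_erase, add_comm,
      Finset.card_erase_add_one (mem_supp.mpr hi)]

@[simp]
lemma word_expo (a : Fin n → F) : word F n (expo a) = a := by
  induction a using word_induction with
  | h0 => simp
  | hs a i hi ih =>
    rw [expo_eq_single_add_expo_erase hi, map_add, ih, word_single, one_smul, Units.val_mk0,
      single_add_erase]

lemma expo_injective : Function.Injective (expo : (Fin n → F) → _) :=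
  Function.LeftInverse.injective word_expo

variable {ord : MonomialOrder (Fin n × Fˣ)}

lemma card_le_of_expo_le (hdeg : DegreeCompatible ord) {a b : Fin n → F}
    (h : expo a ≼[ord] expo b) : (supp a).card ≤ (supp b).card := by
  by_contra! hlt
  exact (hdeg (expo b) (expo a) (by simpa using hlt)).not_ge h

lemma expo_lt_or_gt {a b : Fin n → F} (h : a ≠ b) :
    expo a ≺[ord] expo b ∨ expo b ≺[ord] expo a :=
  lt_or_gt_of_ne fun h' => h (expo_injective (ord.toSyn.injective h'))

/-- Where the supports overlap, entries merge or cancel, so the left side has strictly smaller total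
degree. -/
lemma expo_add_le (hdeg : DegreeCompatible ord) (a b : Fin n → F) :
    expo (a + b) ≼[ord] expo a + expo b := by
  by_cases h : Disjoint (supp a) (supp b)
  · rw [expo_add_of_disjoint h]
  · refine (hdeg _ _ ?_).le
    rw [map_add, degree_expo, degree_expo, degree_expo]
    have h1 := Finset.card_le_card (supp_add_subset a b)
    have h2 := Finset.card_union_add_card_inter (supp a) (supp b)
    have h3 : 0 < (supp a ∩ supp b).card :=
      Finset.card_pos.mpr (Finset.not_disjoint_iff_nonempty_inter.mp h)
    omega

/-- Among all monomials representing a given word, `x ^ Δ` of that word is least. Comparing words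
therefore suffices to compare all monomials of a coset. -/
lemma expo_word_le (hdeg : DegreeCompatible ord) (s : Fin n × Fˣ →₀ ℕ) :
    expo (word F n s) ≼[ord] s := by
  have hadd : ∀ s t : Fin n × Fˣ →₀ ℕ, expo (word F n s) ≼[ord] s → expo (word F n t) ≼[ord] t →
      expo (word F n (s + t)) ≼[ord] s + t := by
    intro s t hs ht
    rw [map_add]
    refine (expo_add_le hdeg _ _).trans ?_
    rw [map_add, map_add]
    exact add_le_add hs ht
  induction s using Finsupp.induction_linear with
  | zero => simp
  | add s t hs ht => exact hadd s t hs ht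
  | single p k =>
    induction k with
    | zero => simp
    | succ k ih =>
      rw [Finsupp.single_add]
      refine hadd _ _ ih ?_
      rw [word_single, one_smul, expo_single]

end Expo

/-! ### The reduced Gröbner basis of the ideal of a code -/

section Groebner

variable {F : Type*} [Field F] {n : ℕ} (K : Type*) [Field K]

/-- The homomorphism from the polynomial ring to the group algebra of `Fⁿ / C` sending a monomial
to the class of the word that it represents. -/
def cosetHom (C : Submodule F (Fin n → F)) :
    MvPolynomial (Fin n × Fˣ) K →ₐ[K] AddMonoidAlgebra K ((Fin n → F) ⧸ C) :=
  MvPolynomial.aeval fun p => AddMonoidAlgebra.single (C.mkQ (Pi.single p.1 (p.2 : F))) 1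

variable {K}

lemma cosetHom_monomial (C : Submodule F (Fin n → F)) (s : Fin n × Fˣ →₀ ℕ) (k : K) :
    cosetHom K C (MvPolynomial.monomial s k) =
      AddMonoidAlgebra.single (C.mkQ (word F n s)) k := by
  have h1 : ∀ s : Fin n × Fˣ →₀ ℕ, cosetHom K C (MvPolynomial.monomial s 1) =
      AddMonoidAlgebra.single (C.mkQ (word F n s)) 1 := by
    intro s
    induction s using Finsupp.induction_linear with
    | zero => rw [MvPolynomial.monomial_zero', map_one, map_one, map_zero, map_zero,
        AddMonoidAlgebra.one_def]
    | add s t hs ht =>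
      have : (MvPolynomial.monomial (s + t) (1 : K)) =
          MvPolynomial.monomial s 1 * MvPolynomial.monomial t 1 := by
        rw [MvPolynomial.monomial_mul, one_mul]
      rw [this, map_mul, hs, ht, AddMonoidAlgebra.single_mul_single, map_add, map_add, one_mul]
    | single p k =>
      rw [← MvPolynomial.X_pow_eq_monomial, map_pow, cosetHom, MvPolynomial.aeval_X,
        AddMonoidAlgebra.single_pow, one_pow, word_single, map_nsmul]
  have : MvPolynomial.monomial s k = k • MvPolynomial.monomial s (1 : K) := by
    rw [MvPolynomial.smul_monomial, smul_eq_mul, mul_one]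
  rw [this, map_smul, h1, AddMonoidAlgebra.smul_single, smul_eq_mul, mul_one]

/-- A monomial of `f` that is the only one of its coset keeps `f` out of the kernel. -/
lemma cosetHom_ne_zero (C : Submodule F (Fin n → F)) {f : MvPolynomial (Fin n × Fˣ) K}
    {s : Fin n × Fˣ →₀ ℕ} (hs : s ∈ f.support)
    (h : ∀ t ∈ f.support, word F n s - word F n t ∈ C → t = s) : cosetHom K C f ≠ 0 := by
  intro h0
  have hf := f.as_sum
  rw [hf, map_sum] at h0
  have hc := congrArg (fun x => x.coeff (C.mkQ (word F n s))) h0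
  simp only [cosetHom_monomial, AddMonoidAlgebra.coeff_sum, Finsupp.finsetSum_apply,
    AddMonoidAlgebra.coeff_single, AddMonoidAlgebra.coeff_zero, Finsupp.zero_apply] at hc
  rw [Finset.sum_eq_single s] at hc
  · rw [Finsupp.single_eq_same] at hc
    exact MvPolynomial.mem_support_iff.mp hs hc
  · intro t ht hts
    refine Finsupp.single_eq_of_ne fun he => hts (h t ht ?_)
    exact (Submodule.Quotient.eq C).mp he
  · exact fun h' => (h' hs).elim

lemma additionIdeal_le_ker : additionIdeal F n K ≤
    RingHom.ker (cosetHom K (⊥ : Submodule F (Fin n → F))) := by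
  refine iSup_le fun i => sup_le (Ideal.span_le.mpr ?_) (Ideal.span_le.mpr ?_)
  · rintro _ ⟨u, v, w, h, rfl⟩
    rw [SetLike.mem_coe, RingHom.mem_ker, map_sub, map_mul]
    simp only [cosetHom, MvPolynomial.aeval_X, AddMonoidAlgebra.single_mul_single, ← map_add,
      ← Pi.single_add, h, mul_one, sub_self]
  · rintro _ ⟨u, v, h, rfl⟩
    rw [SetLike.mem_coe, RingHom.mem_ker, map_sub, map_mul, map_one]
    simp only [cosetHom, MvPolynomial.aeval_X, AddMonoidAlgebra.single_mul_single, ← map_add,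
      ← Pi.single_add, h, mul_one, Pi.single_zero, map_zero, AddMonoidAlgebra.one_def, sub_self]

variable [Finite F]

lemma cosetHom_wordMonomial (C : Submodule F (Fin n → F)) (a : Fin n → F) :
    cosetHom K C (wordMonomial K a) = AddMonoidAlgebra.single (C.mkQ a) 1 := by
  rw [wordMonomial, cosetHom_monomial, word_expo]

/-- This inclusion alone is enough: the kernel serves to exclude leading monomials, never to produce
elements of the ideal. -/
lemma codeIdeal_le_ker (C : Submodule F (Fin n → F)) :
    codeIdeal K C ≤ RingHom.ker (cosetHom K C) := by
  refine Ideal.span_le.mpr ?_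
  rintro _ ⟨a, b, hab, rfl⟩
  have : C.mkQ a = C.mkQ b := (Submodule.Quotient.eq C).mpr hab
  rw [SetLike.mem_coe, RingHom.mem_ker, map_sub, cosetHom_wordMonomial, cosetHom_wordMonomial,
    this, sub_self]

/-- The addition ideal vanishes in the group algebra of `Fⁿ` (the case `C = ⊥`), where distinct
words stay distinct. So the clause on `additionIdeal` in `groebnerWords` is automatic for `a ≠ b`.
-/
lemma wordMonomial_sub_notMem_additionIdeal {a b : Fin n → F} (hab : a ≠ b) :
    wordMonomial K a - wordMonomial K b ∉ additionIdeal F n K := by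
  intro h
  have h0 := additionIdeal_le_ker h
  rw [RingHom.mem_ker, map_sub, cosetHom_wordMonomial, cosetHom_wordMonomial, sub_eq_zero] at h0
  have := congrArg (fun x => x.coeff ((⊥ : Submodule F (Fin n → F)).mkQ a)) h0
  simp only [AddMonoidAlgebra.coeff_single, Finsupp.single_eq_same] at this
  rw [Finsupp.single_eq_of_ne] at this
  · exact one_ne_zero this
  · intro he
    have := (Submodule.Quotient.eq _).mp he
    exact hab (sub_eq_zero.mp (by simpa using this))

variable {ord : MonomialOrder (Fin n × Fˣ)} {C : Submodule F (Fin n → F)}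

/-- The word is least in its coset modulo `C`. -/
def IsCosetLeast (ord : MonomialOrder (Fin n × Fˣ)) (C : Submodule F (Fin n → F))
    (a : Fin n → F) : Prop :=
  ∀ b, a - b ∈ C → expo a ≼[ord] expo b

lemma exists_isCosetLeast (ord : MonomialOrder (Fin n × Fˣ)) (C : Submodule F (Fin n → F))
    (a : Fin n → F) : ∃ b, a - b ∈ C ∧ IsCosetLeast ord C b := by
  have hne : {b | a - b ∈ C}.Nonempty := ⟨a, by simp⟩
  obtain ⟨b, hb, hmin⟩ :=
    (InvImage.wf (fun b : Fin n → F => ord.toSyn (expo b)) wellFounded_lt).has_min _ hne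
  refine ⟨b, hb, fun c hc => not_lt.mp (hmin c ?_)⟩
  have := C.add_mem hb hc
  simpa using this

/-- By `expo_word_le`, any monomial of `f` in the coset of `a` is at least `expo a`. A leading
monomial `expo a` would thus be alone in its coset and survive in the group algebra, where `f` is
zero. -/
lemma degree_ne_expo_of_isCosetLeast (hdeg : DegreeCompatible ord)
    {f : MvPolynomial (Fin n × Fˣ) K} (hf : f ∈ codeIdeal K C) (h0 : f ≠ 0) {a : Fin n → F}
    (ha : IsCosetLeast ord C a) : ord.degree f ≠ expo a := by
  intro hd
  refine cosetHom_ne_zero C (ord.degree_mem_support h0) (fun t ht htC => ?_)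
    (codeIdeal_le_ker C hf)
  rw [hd, word_expo] at htC
  have h1 : ord.degree f ≼[ord] t := hd ▸ (ha _ htC).trans (expo_word_le hdeg t)
  exact ord.toSyn.injective (le_antisymm (ord.le_degree ht) h1)

variable {G : Set (MvPolynomial (Fin n × Fˣ) K)}

lemma exists_degree_le (hG : IsReducedGroebnerBasis ord (codeIdeal K C) G)
    {f : MvPolynomial (Fin n × Fˣ) K} (hf : f ∈ codeIdeal K C) (h0 : f ≠ 0) :
    ∃ g ∈ G, ord.degree g ≤ ord.degree f := by
  have hmem : MvPolynomial.monomial (ord.degree f) (1 : K) ∈ initialIdeal ord (codeIdeal K C) :=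
    Ideal.subset_span ⟨f, hf, h0, rfl⟩
  rw [hG.span_initial] at hmem
  have himg : {t | ∃ g ∈ G, t = MvPolynomial.monomial (ord.degree g) (1 : K)} =
      (fun s => MvPolynomial.monomial s 1) '' (ord.degree '' G) := by
    ext t
    simp [eq_comm]
  rw [himg, MvPolynomial.mem_ideal_span_monomial_image] at hmem
  classical
  obtain ⟨_, ⟨g, hg, rfl⟩, hle⟩ := hmem (ord.degree f) (by
    rw [MvPolynomial.mem_support_iff, MvPolynomial.coeff_monomial, if_pos rfl]
    exact one_ne_zero)
  exact ⟨g, hg, hle⟩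

/-- If `a` is not least in its coset but each word obtained by erasing an entry of `a` is, then
`x ^ Δ a` is the leading monomial of an element of the reduced Gröbner basis. -/
lemma exists_sub_mem_groebner (hdeg : DegreeCompatible ord)
    (hG : IsReducedGroebnerBasis ord (codeIdeal K C) G) {a b : Fin n → F} (hab : a - b ∈ C)
    (hlt : expo b ≺[ord] expo a) (hsub : ∀ i ∈ supp a, IsCosetLeast ord C (erase a i)) :
    ∃ b', a - b' ∈ C ∧ expo b' ≼[ord] expo b ∧ a ≠ b' ∧
      (a - b' ∈ minSupportWords C → a - b' ∈ groebnerWords ord C G) := by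
  classical
  obtain ⟨b', hab', hb'⟩ := exists_isCosetLeast ord C a
  have hbb : expo b' ≼[ord] expo b := hb' b (by simpa using C.sub_mem hab hab')
  have hlt' : expo b' ≺[ord] expo a := hbb.trans_lt hlt
  have hne : a ≠ b' := by
    rintro rfl
    exact hlt'.ne rfl
  refine ⟨b', hab', hbb, hne, fun hmin => ⟨⟨hab', a, b', ?_,
    wordMonomial_sub_notMem_additionIdeal hne, hlt', rfl⟩, hmin⟩⟩
  set f : MvPolynomial (Fin n × Fˣ) K := wordMonomial K a - wordMonomial K b' with hf
  have hfI : f ∈ codeIdeal K C := Ideal.subset_span ⟨a, b', hab', rfl⟩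
  have hexp : expo a ≠ expo b' := fun h => hne (expo_injective h)
  have hcoeff : ∀ s, f.coeff s = (if expo a = s then 1 else 0) - if expo b' = s then 1 else 0 := by
    intro s
    rw [hf, MvPolynomial.coeff_sub, wordMonomial, wordMonomial, MvPolynomial.coeff_monomial,
      MvPolynomial.coeff_monomial]
  have hfa : f.coeff (expo a) = 1 := by simp [hcoeff, hexp.symm]
  have hf0 : f ≠ 0 := by
    intro h
    simp [h] at hfa
  have hfsupp : ∀ s ∈ f.support, s = expo a ∨ s = expo b' := by
    intro s hs
    by_contra! h
    rw [MvPolynomial.mem_support_iff, hcoeff, if_neg h.1.symm, if_neg h.2.symm] at hs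
    simp at hs
  have hfd : ord.degree f = expo a := by
    rcases hfsupp _ (ord.degree_mem_support hf0) with h | h
    · exact h
    · have := ord.le_degree (f := f) (d := expo a) (by simp [MvPolynomial.mem_support_iff, hfa])
      rw [h] at this
      exact (this.not_gt hlt').elim
  obtain ⟨g, hg, hgle⟩ := exists_degree_le hG hfI hf0
  rw [hfd] at hgle
  have hg0 : g ≠ 0 := (hG.monic g hg).ne_zero
  have hgd : ord.degree g = expo a := by
    -- Since `expo a` is square-free, a proper divisor of it divides the exponent of some `erase a
    -- i`. A monomial multiple of `g` would then lead with the monomial of a coset-least word.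
    by_contra hgne
    obtain ⟨⟨i, u⟩, hp⟩ : ∃ p, ord.degree g p < expo a p := by
      by_contra! h
      exact hgne (le_antisymm hgle h)
    have hau : a i = (u : F) := by
      by_contra h
      simp [expo_apply, h] at hp
    have hi : a i ≠ 0 := hau ▸ u.ne_zero
    have hle : ord.degree g ≤ expo (erase a i) := by
      intro p
      by_cases hpi : p = (i, u)
      · subst hpi
        have h1 : expo a (i, u) ≤ 1 := by
          rw [expo_apply]; split_ifs <;> simp
        have : ord.degree g (i, u) = 0 := by omega
        rw [this]
        exact Nat.zero_le _
      · have h1 := hgle p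
        rw [expo_eq_single_add_expo_erase hi, Finsupp.add_apply, Finsupp.single_eq_of_ne,
          zero_add] at h1
        · exact h1
        · rintro rfl
          exact hpi (Prod.ext rfl (Units.ext hau))
    have hmul : ord.degree (MvPolynomial.monomial (expo (erase a i) - ord.degree g) 1 * g) =
        expo (erase a i) := by
      rw [ord.degree_mul (by simp) hg0, ord.degree_monomial, if_neg one_ne_zero,
        tsub_add_cancel_of_le hle]
    exact degree_ne_expo_of_isCosetLeast hdeg (Ideal.mul_mem_left _ _ (hG.subset hg))
      (mul_ne_zero (by simp) hg0) (hsub i (mem_supp.mpr hi)) hmul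
  have hgf : g = f := by
    -- The common leading term cancels in `g - f`. Its new leading monomial either occurs in `g`,
    -- against reducedness, or is `expo b'`, against `b'` being least in its coset.
    by_contra hgf
    have h0 : g - f ≠ 0 := sub_ne_zero.mpr hgf
    have hI : g - f ∈ codeIdeal K C := Ideal.sub_mem _ (hG.subset hg) hfI
    set t := ord.degree (g - f) with ht
    have hts : (g - f).coeff t ≠ 0 := MvPolynomial.mem_support_iff.mp (ord.degree_mem_support h0)
    have hta : t ≠ expo a := by
      intro h
      rw [h, MvPolynomial.coeff_sub, hfa, ← hgd, (hG.monic g hg).coeff_degree, sub_self] at hts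
      exact hts rfl
    by_cases htg : t ∈ g.support
    · obtain ⟨g', hg', hle⟩ := exists_degree_le hG hI h0
      by_cases hgg : g' = g
      · subst hgg
        refine hta (ord.toSyn.injective (le_antisymm ?_ ?_))
        · exact hgd ▸ ord.le_degree htg
        · exact hgd ▸ ord.toSyn_monotone hle
      · exact hG.reduced g' hg' g hg hgg t htg hle
    · have htb : t = expo b' := by
        refine (hfsupp t ?_).resolve_left hta
        rw [MvPolynomial.notMem_support_iff] at htg
        rw [MvPolynomial.mem_support_iff]
        intro h
        rw [MvPolynomial.coeff_sub, htg, h, sub_self] at hts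
        exact hts rfl
      exact degree_ne_expo_of_isCosetLeast hdeg hI h0 hb' htb
  exact hgf ▸ hg

end Groebner

/-! ### Codewords of small weight coming from the Gröbner basis -/

section SmallWords

variable {F : Type*} [Field F] {n : ℕ}

lemma supp_subset_of_mem_span {m x : Fin n → F} (h : x ∈ Submodule.span F {m}) :
    supp x ⊆ supp m := by
  obtain ⟨t, rfl⟩ := Submodule.mem_span_singleton.mp h
  exact supp_smul_subset t m

lemma supp_eq_of_mem_span {m x : Fin n → F} (h : x ∈ Submodule.span F {m}) (hx : x ≠ 0) :
    supp x = supp m := by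
  obtain ⟨t, rfl⟩ := Submodule.mem_span_singleton.mp h
  refine supp_smul ?_ m
  rintro rfl
  simp at hx

lemma ghw_two_le_of_notMem_span {C : Submodule F (Fin n → F)} {x y : Fin n → F} (hxC : x ∈ C)
    (hyC : y ∈ C) (hx : x ≠ 0) (hy : y ∉ Submodule.span F {x}) :
    ghw C 2 ≤ (supp x ∪ supp y).card :=
  ghw_two_le hxC hyC hx fun t ht => hy (Submodule.mem_span_singleton.mpr ⟨t, ht⟩)

lemma card_supp_sub_le (a b : Fin n → F) : (supp (a - b)).card ≤ (supp a).card + (supp b).card :=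
  (Finset.card_le_card (supp_sub_subset a b)).trans (Finset.card_union_le _ _)

lemma card_supp_add_le (a b : Fin n → F) : (supp (a + b)).card ≤ (supp a).card + (supp b).card :=
  (Finset.card_le_card (supp_add_subset a b)).trans (Finset.card_union_le _ _)

lemma card_supp_erase {a : Fin n → F} {i : Fin n} (hi : i ∈ supp a) :
    (supp (erase a i)).card + 1 = (supp a).card := by
  rw [supp_erase, Finset.card_erase_add_one hi]

lemma supp_erase_subset (a : Fin n → F) (i : Fin n) : supp (erase a i) ⊆ supp a := by
  rw [supp_erase]
  exact Finset.erase_subset _ _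

/-- A word is the difference of two words of almost equal weights whose supports partition its
support, the first of which may be prescribed to contain a small set. -/
lemma exists_balanced_split (m : Fin n → F) {S : Finset (Fin n)} (hS : S ⊆ supp m)
    (hcard : 2 * S.card ≤ (supp m).card + 1) :
    ∃ a b : Fin n → F, m = a - b ∧ Disjoint (supp a) (supp b) ∧ supp a ∪ supp b = supp m ∧
      S ⊆ supp a ∧ (supp a).card + (supp b).card = (supp m).card ∧
      (supp b).card ≤ (supp a).card ∧ (supp a).card ≤ (supp b).card + 1 := by
  obtain ⟨T, hST, hTm, hT⟩ := Finset.exists_subsuperset_card_eq (n := ((supp m).card + 1) / 2) hS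
    (by omega) (by omega)
  obtain ⟨a, b, hm, ha, hb⟩ := exists_split m hTm
  have hb' := Finset.card_sdiff_of_subset hTm
  refine ⟨a, b, hm, ?_, ?_, ha ▸ hST, ?_⟩
  · rw [ha, hb]
    exact Finset.disjoint_sdiff
  · rw [ha, hb, Finset.union_sdiff_of_subset hTm]
  · rw [ha, hb, hb', hT]
    omega

variable {C : Submodule F (Fin n → F)}

/-- Balanced splittings `a - b` of the codewords of weight `w` that span with `m` a subcode of
weight `d₂(C)`, where the support of `b` does not meet that of `m`. -/
structure IsBalancedPair (C : Submodule F (Fin n → F)) (m : Fin n → F) (w : ℕ)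
    (a b : Fin n → F) : Prop where
  mem : a - b ∈ C
  notMem_span : a - b ∉ Submodule.span F {m}
  card_union : (supp m ∪ supp a).card + (supp b).card = ghw C 2
  card_add : (supp a).card + (supp b).card = w
  le : (supp b).card ≤ (supp a).card
  le_succ : (supp a).card ≤ (supp b).card + 1

lemma card_union_supp_sub_le (m a b : Fin n → F) :
    (supp m ∪ supp (a - b)).card ≤ (supp m ∪ supp a).card + (supp b).card := by
  refine (Finset.card_le_card ?_).trans (Finset.card_union_le _ _)
  rw [Finset.union_assoc]
  exact Finset.union_subset_union_right (supp_sub_subset a b)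

/-- The upper bounds are forced to be equalities: `d₂` bounds the weight of the plane from below and
`hmin` bounds the weight of `x - y`. Exchanging a component for one no heavier therefore preserves
balance. -/
lemma isBalancedPair_of_card_le {m : Fin n → F} {w : ℕ} (hm : m ∈ C) (hm0 : m ≠ 0)
    (hmin : ∀ x ∈ C, x ∉ Submodule.span F {m} → (supp m ∪ supp x).card ≤ ghw C 2 →
      w ≤ (supp x).card) {a b x y : Fin n → F} (hab : IsBalancedPair C m w a b)
    (hmem : x - y ∈ C) (hspan : x - y ∉ Submodule.span F {m})
    (hu : (supp m ∪ supp x).card ≤ (supp m ∪ supp a).card)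
    (hx : (supp x).card ≤ (supp a).card) (hy : (supp y).card ≤ (supp b).card) :
    IsBalancedPair C m w x y := by
  have h1 := card_union_supp_sub_le m x y
  have h2 := ghw_two_le_of_notMem_span hm hmem hm0 hspan
  have h3 := hab.card_union
  have h4 := hmin _ hmem hspan (by omega)
  have h5 := card_supp_sub_le x y
  have h6 := hab.card_add
  have h7 := hab.le
  have h8 := hab.le_succ
  exact ⟨hmem, hspan, by omega, by omega, by omega, by omega⟩

variable [Finite F] {K : Type*} [Field K] {ord : MonomialOrder (Fin n × Fˣ)}
  {G : Set (MvPolynomial (Fin n × Fˣ) K)}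

lemma isCosetLeast_of_forall_not_lt {a : Fin n → F}
    (h : ∀ b, a - b ∈ C → a - b ≠ 0 → (expo b ≺[ord] expo a) → False) : IsCosetLeast ord C a := by
  intro b hb
  by_contra! hlt
  refine h b hb ?_ hlt
  intro h0
  rw [sub_eq_zero.mp h0] at hlt
  exact hlt.ne rfl

/-- Some codeword of minimum weight belongs to `M_G`. -/
lemma exists_mem_groebnerWords_card_eq_ghw_one (hC : 1 ≤ Module.finrank F C)
    (hdeg : DegreeCompatible ord) (hG : IsReducedGroebnerBasis ord (codeIdeal K C) G) :
    ∃ c ∈ groebnerWords ord C G, (supp c).card = ghw C 1 := by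
  have key : ∀ a b : Fin n → F, a - b ∈ C → (expo b ≺[ord] expo a) →
      (supp a).card ≤ (supp b).card + 1 → (supp a).card + (supp b).card = ghw C 1 →
      ∃ c ∈ groebnerWords ord C G, (supp c).card = ghw C 1 := by
    intro a b hab hlt h1 hw
    -- A smaller word in the coset of `erase a i` would give a nonzero codeword of weight at most `2
    -- * (|a| - 1)`, which is less than `|a| + |b|` by balance.
    obtain ⟨b', hab', hle, hne, hmem⟩ := exists_sub_mem_groebner hdeg hG hab hlt (by
      intro i hi
      refine isCosetLeast_of_forall_not_lt fun b'' hb'' h0 hlt' => ?_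
      have hc := card_le_of_expo_le hdeg hlt'.le
      have h2 := card_supp_erase hi
      have h3 := card_supp_sub_le (erase a i) b''
      have h4 := ghw_one_le hb'' h0
      omega)
    have h0 : a - b' ≠ 0 := sub_ne_zero.mpr hne
    have hc := card_le_of_expo_le hdeg hle
    have h2 := card_supp_sub_le a b'
    have h3 := ghw_one_le hab' h0
    exact ⟨a - b', hmem (mem_minSupportWords_of_card_le_ghw_one hab' h0 (by omega)), by omega⟩
  obtain ⟨c, hcC, hc0, hcw⟩ := exists_card_supp_eq_ghw_one hC
  obtain ⟨a, b, rfl, -, -, -, hsum, hba, hab⟩ :=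
    exists_balanced_split c (Finset.empty_subset _) (by simp)
  rcases expo_lt_or_gt (ord := ord) (sub_ne_zero.mp hc0) with h | h
  · have := card_le_of_expo_le hdeg h.le
    exact key b a (by simpa using C.neg_mem hcC) h (by omega) (by omega)
  · exact key a b hcC h hab (by omega)

/-- A word that is least among the codewords spanning with another one a subcode of weight
`d₂(C)` has the support of an element of `M_G`. -/
lemma exists_mem_groebnerWords_supp_eq (hdeg : DegreeCompatible ord) (hneg : NegCompatible ord)
    (hG : IsReducedGroebnerBasis ord (codeIdeal K C) G) {m : Fin n → F} (hm : m ∈ C) (hm0 : m ≠ 0)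
    (hleast : ∀ x ∈ C, x ∉ Submodule.span F {m} → (supp m ∪ supp x).card ≤ ghw C 2 →
      expo m ≼[ord] expo x)
    (hlt : (supp m).card < ghw C 2) (hw : (supp m).card + (supp m).card / 2 ≤ ghw C 2) :
    ∃ c ∈ groebnerWords ord C G, supp c = supp m := by
  have key : ∀ a b : Fin n → F, a - b ∈ C → a - b = m ∨ b - a = m → (expo b ≺[ord] expo a) →
      Disjoint (supp a) (supp b) → supp a ∪ supp b = supp m →
      (supp a).card ≤ (supp b).card + 1 → (supp a).card + (supp b).card = (supp m).card →
      ∃ c ∈ groebnerWords ord C G, supp c = supp m := by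
    intro a b hab hor hba hdis hunion h1 hsum
    have hIa : supp a ⊆ supp m := hunion ▸ Finset.subset_union_left
    have hIb : supp b ⊆ supp m := hunion ▸ Finset.subset_union_right
    have hcab := card_le_of_expo_le hdeg hba.le
    have hbound : ∀ x y : Fin n → F, supp x ⊆ supp m →
        (supp m ∪ supp (x - y)).card ≤ (supp m).card + (supp y).card := by
      intro x y hx
      refine (Finset.card_le_card ?_).trans (Finset.card_union_le _ _)
      refine Finset.union_subset Finset.subset_union_left ((supp_sub_subset x y).trans ?_)
      exact Finset.union_subset_union_left hx
    -- The offending codeword is lighter than `m`, so it is no multiple of `m`. With `m` it has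
    -- weight at most `|m| + |a| - 1 ≤ |m| + |m| / 2 ≤ d₂`, so `hleast` applies and contradicts its
    -- lightness.
    obtain ⟨b', hab', hle, hne, hmem⟩ := exists_sub_mem_groebner hdeg hG hab hba (by
      intro i hi
      refine isCosetLeast_of_forall_not_lt fun b'' hb'' h0 hlt' => ?_
      have hc := card_le_of_expo_le hdeg hlt'.le
      have h2 := card_supp_erase hi
      have h3 := card_supp_sub_le (erase a i) b''
      have h4 := hbound _ b'' ((supp_erase_subset a i).trans hIa)
      have hnp : erase a i - b'' ∉ Submodule.span F {m} := by
        intro hp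
        rw [supp_eq_of_mem_span hp h0] at h3
        omega
      have h5 := card_le_of_expo_le hdeg (hleast _ hb'' hnp (by omega))
      omega)
    have h0 : a - b' ≠ 0 := sub_ne_zero.mpr hne
    by_cases hp : a - b' ∈ Submodule.span F {m}
    · have hs := supp_eq_of_mem_span hp h0
      exact ⟨a - b', hmem (mem_minSupportWords_of_card_lt_ghw_two hab' h0 (hs ▸ hlt)), hs⟩
    exfalso
    have hc := card_le_of_expo_le hdeg hle
    have hb1 := hbound a b' hIa
    have hb2 := ghw_two_le_of_notMem_span hm hab' hm0 hp
    have hsub : supp m ∪ supp (a - b') ⊆ supp m ∪ supp b' :=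
      Finset.union_subset Finset.subset_union_left
        ((supp_sub_subset a b').trans (Finset.union_subset_union_left hIa))
    -- Equality is forced by `|m| + |b'| ≤ |m| + |m| / 2 ≤ d₂ ≤ |supp m ∪ supp b'|`.
    have hdisj : Disjoint (supp m) (supp b') := by
      rw [← Finset.card_union_eq_card_add_card]
      refine le_antisymm (Finset.card_union_le _ _) ?_
      have := Finset.card_le_card hsub
      omega
    have hbb : b' ≠ b := by
      rintro rfl
      refine hp ?_
      rcases hor with h | h
      · exact h ▸ Submodule.mem_span_singleton_self _
      · rw [← neg_sub, h]
        exact Submodule.neg_mem _ (Submodule.mem_span_singleton_self _)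
    have hlt' : expo b' ≺[ord] expo b :=
      lt_of_le_of_ne hle fun h => hbb (expo_injective (ord.toSyn.injective h))
    have hdab' : Disjoint (supp a) (supp b') := hdisj.mono_left hIa
    -- Replacing `b` by `b'` in `m` gives a smaller candidate, against `hleast`. If `m = a - b`, the
    -- block that changes is `-b`, so `b' ≺ b` must pass to negatives; if `m = b - a`, it is `b`
    -- itself.
    rcases hor with h | h
    · have hneg' := hneg b b' (hdisj.mono_left hIb) hlt'
      have hle' := hleast _ hab' hp (by omega)
      rw [← h, sub_eq_add_neg, sub_eq_add_neg, expo_add_of_disjoint (by simpa using hdis),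
        expo_add_of_disjoint (by simpa using hdab'), map_add, map_add] at hle'
      exact hle'.not_gt (add_lt_add_right hneg' _)
    · have hp' : b' - a ∉ Submodule.span F {m} := by
        rw [← neg_sub, Submodule.neg_mem_iff]
        exact hp
      have hs : supp (b' - a) = supp (a - b') := by rw [← neg_sub, supp_neg]
      have hle' := hleast (b' - a) (by simpa using C.neg_mem hab') hp' (by rw [hs]; omega)
      rw [← h, sub_eq_add_neg, sub_eq_add_neg, expo_add_of_disjoint (by simpa using hdis.symm),
        expo_add_of_disjoint (by simpa using hdab'.symm), map_add, map_add] at hle'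
      exact hle'.not_gt (add_lt_add_left hlt' _)
  obtain ⟨a, b, hmab, hdis, hunion, -, hsum, hba, hab⟩ :=
    exists_balanced_split m (Finset.empty_subset _) (by simp)
  have hne : a ≠ b := sub_ne_zero.mp (hmab ▸ hm0)
  rcases expo_lt_or_gt (ord := ord) hne with h | h
  · have := card_le_of_expo_le hdeg h.le
    refine key b a ?_ (Or.inr hmab.symm) h hdis.symm (by rw [Finset.union_comm, hunion])
      (by omega) (by omega)
    rw [← neg_sub, ← hmab]
    exact C.neg_mem hm
  · exact key a b (hmab ▸ hm) (Or.inl hmab.symm) h hdis hunion hab hsum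

/-- There is an element of `M_G` that spans with `m` a subcode of weight `d₂(C)`. -/
lemma exists_mem_groebnerWords_card_union_eq (hdeg : DegreeCompatible ord)
    (hG : IsReducedGroebnerBasis ord (codeIdeal K C) G) {m : Fin n → F} {w : ℕ} (hm : m ∈ C)
    (hm0 : m ≠ 0)
    (hmin : ∀ x ∈ C, x ∉ Submodule.span F {m} → (supp m ∪ supp x).card ≤ ghw C 2 →
      w ≤ (supp x).card)
    (hw : w < ghw C 2) {x y : Fin n → F} (hpair : IsBalancedPair C m w x y) :
    ∃ c ∈ groebnerWords ord C G, (supp m ∪ supp c).card = ghw C 2 := by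
  -- Minimizing the sum of both exponents, not the exponent of the difference, means that lowering
  -- either component alone gives a contradiction.
  obtain ⟨⟨a, b⟩, hab, hleast⟩ :=
    (InvImage.wf (fun p : (Fin n → F) × (Fin n → F) => ord.toSyn (expo p.1 + expo p.2))
      wellFounded_lt).has_min {p | IsBalancedPair C m w p.1 p.2} ⟨(x, y), hpair⟩
  change IsBalancedPair C m w a b at hab
  replace hleast : ∀ x y, IsBalancedPair C m w x y →
      ¬ (expo x + expo y ≺[ord] expo a + expo b) := fun x y h => hleast (x, y) h
  have hpos := fun x y => isBalancedPair_of_card_le (x := x) (y := y) hm hm0 hmin hab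
  have hu := hab.card_union
  have hsum := hab.card_add
  have hba := hab.le
  have hab1 := hab.le_succ
  have hfinal : ∀ x y : Fin n → F, x - y ∈ C → x - y ∉ Submodule.span F {m} →
      (supp x).card + (supp y).card ≤ w → (supp m ∪ supp (x - y)).card ≤ ghw C 2 →
      (x - y ∈ minSupportWords C → x - y ∈ groebnerWords ord C G) →
      ∃ c ∈ groebnerWords ord C G, (supp m ∪ supp c).card = ghw C 2 := by
    intro x y hxy hspan hcard hle hmem
    have h0 : x - y ≠ 0 := fun h => hspan (h ▸ Submodule.zero_mem _)
    have := card_supp_sub_le x y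
    exact ⟨x - y, hmem (mem_minSupportWords_of_card_lt_ghw_two hxy h0 (by omega)),
      le_antisymm hle (ghw_two_le_of_notMem_span hm hxy hm0 hspan)⟩
  have hle_ab := card_union_supp_sub_le m a b
  have hne : a ≠ b := fun h => hab.notMem_span (by simp [h])
  rcases expo_lt_or_gt (ord := ord) hne with hlt | hlt
  · have hcard := card_le_of_expo_le hdeg hlt.le
    obtain ⟨a', hba', hle, hne', hmem⟩ := exists_sub_mem_groebner hdeg hG
      (show b - a ∈ C by simpa using C.neg_mem hab.mem) hlt (by
      intro i hi
      refine isCosetLeast_of_forall_not_lt fun a' ha' _ hlt' => ?_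
      have hc := card_le_of_expo_le hdeg hlt'.le
      have h2 := card_supp_erase hi
      have h3 := card_supp_sub_le (erase b i) a'
      have hbi : b i ≠ 0 := mem_supp.mp hi
      -- Exchange: the erased part of `b` is replaced by `a'`, giving a smaller pair. It could only
      -- fail to be balanced by falling into the span of `m`; then `erase b i - a'` would be a
      -- codeword lighter than `w` satisfying the conditions of `hmin`.
      have hsplit : a - (Pi.single i (b i) + a') = (a - b) + (erase b i - a') := by
        have := single_add_erase b i
        linear_combination -this
      have hspan : a - (Pi.single i (b i) + a') ∉ Submodule.span F {m} := by
        intro hp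
        have hnp : erase b i - a' ∉ Submodule.span F {m} := by
          intro h
          rw [hsplit] at hp
          exact hab.notMem_span ((Submodule.add_mem_iff_left _ h).mp hp)
        have hsub : supp m ∪ supp (erase b i - a') ⊆ supp m ∪ supp (a - b) := by
          have : erase b i - a' = (a - (Pi.single i (b i) + a')) - (a - b) := by
            rw [hsplit]; abel
          rw [this]
          refine Finset.union_subset Finset.subset_union_left ((supp_sub_subset _ _).trans ?_)
          exact Finset.union_subset_union_left (supp_subset_of_mem_span hp)
        have := hmin _ ha' hnp (by have := Finset.card_le_card hsub; omega)
        omega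
      have hcs : (supp (Pi.single i (b i) + a')).card ≤ (supp b).card := by
        have := card_supp_add_le (Pi.single i (b i)) a'
        rw [supp_single hbi, Finset.card_singleton] at this
        omega
      refine hleast _ _ (hpos _ _ (hsplit ▸ C.add_mem hab.mem ha') hspan le_rfl le_rfl hcs) ?_
      rw [map_add, map_add]
      refine add_lt_add_right ((expo_add_le hdeg _ _).trans_lt ?_) _
      conv_rhs => rw [← single_add_erase b i, expo_add_of_disjoint (disjoint_single_erase b i)]
      rw [map_add, map_add]
      exact add_lt_add_right hlt' _)
    have hc := card_le_of_expo_le hdeg hle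
    have haa' : a - a' = (a - b) + (b - a') := by abel
    -- Either `b - a'` differs from `b - a` by a multiple of `m` and is the word sought, or `(a,
    -- a')` is a smaller balanced pair.
    by_cases hp : a - a' ∈ Submodule.span F {m}
    · have hba : b - a' = (a - a') - (a - b) := by abel
      refine hfinal b a' hba' ?_ (by omega) ?_ hmem
      · intro h
        rw [haa'] at hp
        exact hab.notMem_span ((Submodule.add_mem_iff_left _ h).mp hp)
      · refine (Finset.card_le_card ?_).trans (hle_ab.trans hu.le)
        rw [hba]
        refine Finset.union_subset Finset.subset_union_left ((supp_sub_subset _ _).trans ?_)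
        exact Finset.union_subset_union_left (supp_subset_of_mem_span hp)
    · refine (hleast a a' (hpos _ _ (haa' ▸ C.add_mem hab.mem hba') hp le_rfl le_rfl (by omega))
        ?_).elim
      rw [map_add, map_add]
      exact add_lt_add_right (hle.trans_lt hlt) _
  · have hcard := card_le_of_expo_le hdeg hlt.le
    -- Unlike `b`, the word `a` may meet `supp m`, so an exchange of `a` must also keep the union
    -- with `supp m` under control. It does when the two words differ by a multiple of `m`.
    have hunion : ∀ x y : Fin n → F, supp x ⊆ supp a → x - y ∈ Submodule.span F {m} →
        supp y ⊆ supp m ∪ supp a := by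
      intro x y hx hxy
      have : y = x - (x - y) := by abel
      rw [this]
      refine (supp_sub_subset _ _).trans (Finset.union_subset (hx.trans Finset.subset_union_right)
        ((supp_subset_of_mem_span hxy).trans Finset.subset_union_left))
    obtain ⟨b', hab', hle, hne', hmem⟩ := exists_sub_mem_groebner hdeg hG hab.mem hlt (by
      intro i hi
      refine isCosetLeast_of_forall_not_lt fun b' hb' _ hlt' => ?_
      have hc := card_le_of_expo_le hdeg hlt'.le
      have h2 := card_supp_erase hi
      have h3 := card_supp_sub_le (erase a i) b'
      have hai : a i ≠ 0 := mem_supp.mp hi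
      by_cases hp : erase a i - b' ∈ Submodule.span F {m}
      · have hsplit : (Pi.single i (a i) + b') - b = (a - b) - (erase a i - b') := by
          have := single_add_erase a i
          linear_combination this
        have hspan : (Pi.single i (a i) + b') - b ∉ Submodule.span F {m} := by
          rw [hsplit]
          exact fun h => hab.notMem_span ((Submodule.sub_mem_iff_left _ hp).mp h)
        have hcs : (supp (Pi.single i (a i) + b')).card ≤ (supp a).card := by
          have := card_supp_add_le (Pi.single i (a i)) b'
          rw [supp_single hai, Finset.card_singleton] at this
          omega
        have hus : supp m ∪ supp (Pi.single i (a i) + b') ⊆ supp m ∪ supp a := by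
          refine Finset.union_subset Finset.subset_union_left ((supp_add_subset _ _).trans ?_)
          refine Finset.union_subset ?_ (hunion _ _ (supp_erase_subset a i) hp)
          rw [supp_single hai, Finset.singleton_subset_iff]
          exact Finset.mem_union_right _ hi
        refine hleast _ _ (hpos _ _ (hsplit ▸ C.sub_mem hab.mem hb') hspan (Finset.card_le_card hus)
          hcs le_rfl) ?_
        rw [map_add, map_add]
        refine add_lt_add_left ((expo_add_le hdeg _ _).trans_lt ?_) _
        conv_rhs => rw [← single_add_erase a i, expo_add_of_disjoint (disjoint_single_erase a i)]
        rw [map_add, map_add]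
        exact add_lt_add_right hlt' _
      · have h4 := card_union_supp_sub_le m (erase a i) b'
        have h5 := Finset.card_le_card
          (Finset.union_subset_union_right (s := supp m) (supp_erase_subset a i))
        have := hmin _ hb' hp (by omega)
        omega)
    have hc := card_le_of_expo_le hdeg hle
    by_cases hp : a - b' ∈ Submodule.span F {m}
    · have hsplit : b' - b = (a - b) - (a - b') := by abel
      have hspan : b' - b ∉ Submodule.span F {m} := by
        rw [hsplit]
        exact fun h => hab.notMem_span ((Submodule.sub_mem_iff_left _ hp).mp h)
      refine (hleast b' b (hpos _ _ (hsplit ▸ C.sub_mem hab.mem hab') hspan (Finset.card_le_card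
        (Finset.union_subset Finset.subset_union_left (hunion a b' subset_rfl hp)))
        (by omega) le_rfl) ?_).elim
      rw [map_add, map_add]
      exact add_lt_add_left (hle.trans_lt hlt) _
    · refine hfinal a b' hab' hp (by omega) ?_ hmem
      have := card_union_supp_sub_le m a b'
      omega

end SmallWords

/-! ### Graded free modules over a polynomial ring -/

section Graded

open MvPolynomial

variable {σ ι κ K : Type*} [Field K]

/-- `v` is a homogeneous element of degree `j` of the graded free module `⨁ₗ R(-deg l)`. -/
def IsHomogVec (deg : ι → ℕ) (j : ℕ) (v : ι → MvPolynomial σ K) : Prop :=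
  ∀ l, ∀ s ∈ (v l).support, s.degree + deg l = j

/-- The homogeneous component of degree `j` of an element of `⨁ₗ R(-deg l)`. -/
def homogComp (deg : ι → ℕ) (j : ℕ) : (ι → MvPolynomial σ K) →ₗ[K] (ι → MvPolynomial σ K) :=
  LinearMap.pi fun l => if deg l ≤ j then homogeneousComponent (j - deg l) ∘ₗ LinearMap.proj l
    else 0

lemma coeff_homogComp (deg : ι → ℕ) (j : ℕ) (v : ι → MvPolynomial σ K) (l : ι) (s : σ →₀ ℕ) :
    coeff s (homogComp deg j v l) = if s.degree + deg l = j then coeff s (v l) else 0 := by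
  rw [homogComp, LinearMap.pi_apply]
  by_cases h : deg l ≤ j
  · rw [if_pos h, LinearMap.comp_apply, LinearMap.proj_apply, coeff_homogeneousComponent]
    have : s.degree = j - deg l ↔ s.degree + deg l = j := by omega
    simp only [this]
  · rw [if_neg h, if_neg (by omega)]
    simp

lemma isHomogVec_homogComp (deg : ι → ℕ) (j : ℕ) (v : ι → MvPolynomial σ K) :
    IsHomogVec deg j (homogComp deg j v) := by
  intro l s hs
  rw [mem_support_iff, coeff_homogComp] at hs
  by_contra h
  exact hs (if_neg h)

lemma IsHomogVec.coeff_eq_zero {deg : ι → ℕ} {j : ℕ} {v : ι → MvPolynomial σ K}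
    (hv : IsHomogVec deg j v) {l : ι} {s : σ →₀ ℕ} (h : s.degree + deg l ≠ j) :
    coeff s (v l) = 0 := by
  by_contra hs
  exact h (hv l s (mem_support_iff.mpr hs))

lemma IsHomogVec.homogComp_eq {deg : ι → ℕ} {j : ℕ} {v : ι → MvPolynomial σ K}
    (hv : IsHomogVec deg j v) : homogComp deg j v = v := by
  ext l s
  rw [coeff_homogComp]
  split_ifs with h
  · rfl
  · exact (hv.coeff_eq_zero h).symm

lemma IsHomogVec.homogComp_eq_zero {deg : ι → ℕ} {i j : ℕ} {v : ι → MvPolynomial σ K}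
    (hv : IsHomogVec deg j v) (hij : i ≠ j) : homogComp deg i v = 0 := by
  ext l s
  rw [coeff_homogComp]
  split_ifs with h
  · exact hv.coeff_eq_zero (by omega)
  · simp

lemma IsHomogVec.eq_zero_of_lt {deg : ι → ℕ} {j : ℕ} {v : ι → MvPolynomial σ K}
    (hv : IsHomogVec deg j v) {l : ι} (h : j < deg l) : v l = 0 := by
  ext s
  rw [hv.coeff_eq_zero (by omega), coeff_zero]

lemma IsHomogVec.sub {deg : ι → ℕ} {j : ℕ} {v w : ι → MvPolynomial σ K}
    (hv : IsHomogVec deg j v) (hw : IsHomogVec deg j w) : IsHomogVec deg j (v - w) := by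
  intro l s hs
  by_contra h
  rw [mem_support_iff, Pi.sub_apply, coeff_sub, hv.coeff_eq_zero h, hw.coeff_eq_zero h] at hs
  simp at hs

lemma isHomogVec_single [DecidableEq ι] (deg : ι → ℕ) (k : ι) :
    IsHomogVec deg (deg k) (Pi.single k (1 : MvPolynomial σ K)) := by
  intro l s hs
  by_cases h : l = k
  · subst h
    classical
    rw [Pi.single_eq_same, mem_support_iff, coeff_one] at hs
    have : s = 0 := by
      by_contra h
      exact hs (if_neg (Ne.symm h))
    simp [this]
  · simp [h] at hs

lemma IsHomogVec.monomial_smul {deg : ι → ℕ} {j : ℕ} {v : ι → MvPolynomial σ K}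
    (hv : IsHomogVec deg j v) (t : σ →₀ ℕ) :
    IsHomogVec deg (t.degree + j) (monomial t (1 : K) • v) := by
  classical
  intro l s hs
  rw [Pi.smul_apply, smul_eq_mul, mem_support_iff, coeff_monomial_mul'] at hs
  split_ifs at hs with h
  · have := hv l (s - t) (mem_support_iff.mpr (by simpa using hs))
    have hs' : s = (s - t) + t := (tsub_add_cancel_of_le h).symm
    rw [hs', map_add]
    omega
  · exact (hs rfl).elim

lemma IsHomogVec.sum_smul [Fintype κ] {deg : ι → ℕ} {deg' : κ → ℕ} {j : ℕ}
    {v : κ → MvPolynomial σ K} (hv : IsHomogVec deg' j v) {w : κ → ι → MvPolynomial σ K}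
    (hw : ∀ k, IsHomogVec deg (deg' k) (w k)) : IsHomogVec deg j (∑ k, v k • w k) := by
  classical
  intro l s hs
  rw [mem_support_iff, Finset.sum_apply, coeff_sum] at hs
  obtain ⟨k, -, hk⟩ := Finset.exists_ne_zero_of_sum_ne_zero hs
  rw [Pi.smul_apply, smul_eq_mul] at hk
  obtain ⟨a, ha, b, hb, rfl⟩ := Finset.mem_add.mp (support_mul _ _ (mem_support_iff.mpr hk))
  have h1 := hv k a ha
  have h2 := hw k l b hb
  rw [map_add]
  omega

lemma exists_eq_sum_homogComp [Finite ι] (deg : ι → ℕ) (v : ι → MvPolynomial σ K) :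
    ∃ N, v = ∑ j ∈ Finset.range N, homogComp deg j v := by
  classical
  cases nonempty_fintype ι
  refine ⟨∑ l, ((v l).totalDegree + deg l) + 1, ?_⟩
  ext l s
  rw [Finset.sum_apply, coeff_sum]
  simp only [coeff_homogComp]
  by_cases hs : s ∈ (v l).support
  · rw [Finset.sum_ite_eq, if_pos]
    have h1 : s.degree ≤ (v l).totalDegree := by
      rw [Finsupp.degree_apply]
      exact le_totalDegree hs
    have h2 : (v l).totalDegree + deg l ≤ ∑ l, ((v l).totalDegree + deg l) :=
      Finset.single_le_sum (f := fun l => (v l).totalDegree + deg l) (fun _ _ => Nat.zero_le _)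
        (Finset.mem_univ l)
    rw [Finset.mem_range]
    omega
  · rw [notMem_support_iff] at hs
    simp [hs]

/-- The linear map is homogeneous of degree zero. -/
def IsHomogMap [DecidableEq κ] (deg' : κ → ℕ) (deg : ι → ℕ)
    (d : (κ → MvPolynomial σ K) →ₗ[MvPolynomial σ K] (ι → MvPolynomial σ K)) : Prop :=
  ∀ k, IsHomogVec deg (deg' k) (d (Pi.single k 1))

lemma map_eq_sum_smul [Fintype κ] [DecidableEq κ] {R M : Type*} [Semiring R] [AddCommMonoid M]
    [Module R M] (d : (κ → R) →ₗ[R] M) (v : κ → R) : d v = ∑ k, v k • d (Pi.single k 1) := by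
  conv_lhs => rw [← Finset.univ_sum_single v, map_sum]
  refine Finset.sum_congr rfl fun k _ => ?_
  rw [← map_smul, ← Pi.single_smul, smul_eq_mul, mul_one]

lemma IsHomogMap.map_isHomogVec [Fintype κ] [DecidableEq κ] {deg' : κ → ℕ} {deg : ι → ℕ}
    {d : (κ → MvPolynomial σ K) →ₗ[MvPolynomial σ K] (ι → MvPolynomial σ K)}
    (hd : IsHomogMap deg' deg d) {j : ℕ} {v : κ → MvPolynomial σ K} (hv : IsHomogVec deg' j v) :
    IsHomogVec deg j (d v) := by
  rw [map_eq_sum_smul]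
  exact hv.sum_smul hd

/-- This makes kernels graded and allows preimages of homogeneous elements to be taken homogeneous.
-/
lemma IsHomogMap.map_homogComp [Fintype κ] [DecidableEq κ] {deg' : κ → ℕ} {deg : ι → ℕ}
    {d : (κ → MvPolynomial σ K) →ₗ[MvPolynomial σ K] (ι → MvPolynomial σ K)}
    (hd : IsHomogMap deg' deg d) (j : ℕ) (v : κ → MvPolynomial σ K) :
    d (homogComp deg' j v) = homogComp deg j (d v) := by
  obtain ⟨N, hN⟩ := exists_eq_sum_homogComp deg' v
  have hlt : ∀ i, homogComp deg j (d (homogComp deg' i v)) =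
      if i = j then d (homogComp deg' j v) else 0 := by
    intro i
    split_ifs with h
    · subst h
      exact (hd.map_isHomogVec (isHomogVec_homogComp _ _ _)).homogComp_eq
    · exact (hd.map_isHomogVec (isHomogVec_homogComp _ _ _)).homogComp_eq_zero (Ne.symm h)
  by_cases hj : j ∈ Finset.range N
  · conv_rhs => rw [hN, map_sum, map_sum, Finset.sum_congr rfl fun i _ => hlt i,
      Finset.sum_ite_eq', if_pos hj]
  · have h0 : homogComp deg' j v = 0 := by
      conv_lhs => rw [hN, map_sum]
      refine Finset.sum_eq_zero fun i hi => ?_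
      refine (isHomogVec_homogComp deg' i v).homogComp_eq_zero ?_
      rintro rfl
      exact hj hi
    conv_rhs => rw [hN, map_sum, map_sum, Finset.sum_congr rfl fun i _ => hlt i,
      Finset.sum_ite_eq', if_neg hj]
    rw [h0, map_zero]

/-- The submodule contains the homogeneous components of its elements. -/
def IsGradedSub (deg : ι → ℕ) (N : Submodule (MvPolynomial σ K) (ι → MvPolynomial σ K)) : Prop :=
  ∀ v ∈ N, ∀ j, homogComp deg j v ∈ N

lemma IsHomogMap.isGradedSub_ker [Fintype κ] [DecidableEq κ] {deg' : κ → ℕ} {deg : ι → ℕ}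
    {d : (κ → MvPolynomial σ K) →ₗ[MvPolynomial σ K] (ι → MvPolynomial σ K)}
    (hd : IsHomogMap deg' deg d) : IsGradedSub deg' (LinearMap.ker d) := by
  intro v hv j
  rw [LinearMap.mem_ker] at hv ⊢
  rw [hd.map_homogComp, hv, map_zero]

lemma isHomogMap_linearCombination [Fintype κ] [DecidableEq κ] {deg : ι → ℕ} {deg' : κ → ℕ}
    {g : κ → ι → MvPolynomial σ K} (hg : ∀ k, IsHomogVec deg (deg' k) (g k)) :
    IsHomogMap deg' deg (Fintype.linearCombination (MvPolynomial σ K) g) := by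
  intro k
  rw [Fintype.linearCombination_apply_single, one_smul]
  exact hg k

lemma exists_homogeneous_generators [Finite σ] [Finite ι] {deg : ι → ℕ}
    {N : Submodule (MvPolynomial σ K) (ι → MvPolynomial σ K)} (hN : IsGradedSub deg N) :
    ∃ (r : ℕ) (deg' : Fin r → ℕ) (g : Fin r → ι → MvPolynomial σ K),
      (∀ k, IsHomogVec deg (deg' k) (g k)) ∧ Submodule.span _ (Set.range g) = N := by
  set S : Set (ι → MvPolynomial σ K) := {v | v ∈ N ∧ ∃ j, IsHomogVec deg j v} with hS
  have hspan : Submodule.span (MvPolynomial σ K) S = N := by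
    refine le_antisymm (Submodule.span_le.mpr fun v hv => hv.1) fun v hv => ?_
    obtain ⟨M, hM⟩ := exists_eq_sum_homogComp deg v
    rw [hM]
    exact Submodule.sum_mem _ fun j _ =>
      Submodule.subset_span ⟨hN v hv j, j, isHomogVec_homogComp _ _ _⟩
  have hfg : (Submodule.span (MvPolynomial σ K) S).FG := IsNoetherian.noetherian _
  obtain ⟨T, hT, hTS⟩ := (Submodule.fg_span_iff_fg_span_finset_subset S).mp hfg
  choose e he using fun k : T => (hT k.2).2
  refine ⟨T.card, fun k => e (T.equivFin.symm k), fun k => T.equivFin.symm k,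
    fun k => he _, ?_⟩
  rw [← hspan, hTS]
  congr 1
  ext v
  constructor
  · rintro ⟨k, rfl⟩
    exact (T.equivFin.symm k).2
  · intro hv
    exact ⟨T.equivFin ⟨v, hv⟩, by simp⟩

/-- A graded submodule is the image of a homogeneous map from a graded free module of finite rank
whose kernel lies in the irrelevant submodule. -/
lemma exists_minimal_presentation [Finite σ] [Finite ι] {deg : ι → ℕ}
    {N : Submodule (MvPolynomial σ K) (ι → MvPolynomial σ K)} (hN : IsGradedSub deg N) :
    ∃ (r : ℕ) (deg' : Fin r → ℕ)
      (d : (Fin r → MvPolynomial σ K) →ₗ[MvPolynomial σ K] (ι → MvPolynomial σ K)),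
      IsHomogMap deg' deg d ∧ LinearMap.range d = N ∧
      ∀ z ∈ LinearMap.ker d, ∀ k, constantCoeff (z k) = 0 := by
  classical
  have hex := exists_homogeneous_generators hN
  obtain ⟨deg', g, hg, hspan⟩ := Nat.find_spec hex
  -- The number `r` of homogeneous generators is least possible; a syzygy with a nonzero constant
  -- term would let one generator be dropped.
  have hmin := fun r => Nat.find_min (m := r) hex
  generalize Nat.find hex = r at deg' g hg hspan hmin
  have hd := isHomogMap_linearCombination hg
  refine ⟨r, deg', Fintype.linearCombination _ g, hd, ?_, ?_⟩
  · rw [Fintype.range_linearCombination, hspan]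
  intro z hz k
  by_contra hk
  obtain ⟨r, rfl⟩ : ∃ r', r = r' + 1 := Nat.exists_eq_succ_of_ne_zero (by
    rintro rfl
    exact k.elim0)
  -- In this degree the `k`-th coordinate reduces to its constant term, a unit.
  set z' := homogComp deg' (deg' k) z with hz'
  have hzk : z' k = C (constantCoeff (z k)) := by
    ext s
    rw [hz', coeff_homogComp, coeff_C]
    by_cases hs : s = 0
    · simp [hs, constantCoeff_eq]
    · have : s.degree ≠ 0 := by simpa [Finsupp.degree_eq_zero_iff] using hs
      rw [if_neg (by omega), if_neg (Ne.symm hs)]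
  have hker : ∑ i, z' i • g i = 0 := by
    have := hd.isGradedSub_ker z hz (deg' k)
    rwa [LinearMap.mem_ker, Fintype.linearCombination_apply] at this
  rw [Fin.sum_univ_succAbove _ k, hzk] at hker
  refine hmin r (Nat.lt_succ_self r) ⟨deg' ∘ k.succAbove, g ∘ k.succAbove, fun i => hg _, ?_⟩
  rw [← hspan]
  refine le_antisymm (Submodule.span_mono (Set.range_comp_subset_range _ _)) ?_
  rw [Submodule.span_le]
  rintro _ ⟨i, rfl⟩
  have hsub : ∀ j, g (k.succAbove j) ∈
      Submodule.span (MvPolynomial σ K) (Set.range (g ∘ k.succAbove)) :=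
    fun j => Submodule.subset_span ⟨j, rfl⟩
  rcases Fin.eq_self_or_eq_succAbove k i with rfl | ⟨j, rfl⟩
  · have hgi : g i = -((C (constantCoeff (z i))⁻¹ : MvPolynomial σ K) •
        ∑ j, z' (i.succAbove j) • g (i.succAbove j)) := by
      rw [eq_neg_of_add_eq_zero_right hker, smul_neg, neg_neg, smul_smul, ← C_mul,
        inv_mul_cancel₀ hk, C_1, one_smul]
    rw [hgi]
    exact Submodule.neg_mem _ (Submodule.smul_mem _ _
      (Submodule.sum_mem _ fun j _ => Submodule.smul_mem _ _ (hsub j)))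
  · exact hsub j

/-- A graded submodule of a graded free module of finite rank contained in the irrelevant
submodule. -/
structure GradedSub (σ K : Type*) [Field K] where
  rank : ℕ
  deg : Fin rank → ℕ
  sub : Submodule (MvPolynomial σ K) (Fin rank → MvPolynomial σ K)
  graded : IsGradedSub deg sub
  minimal : ∀ v ∈ sub, ∀ l, constantCoeff (v l) = 0

lemma GradedSub.exists_next [Finite σ] (S : GradedSub σ K) :
    ∃ (T : GradedSub σ K)
      (d : (Fin T.rank → MvPolynomial σ K) →ₗ[MvPolynomial σ K] (Fin S.rank → MvPolynomial σ K)),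
      IsHomogMap T.deg S.deg d ∧ LinearMap.range d = S.sub ∧ LinearMap.ker d = T.sub := by
  obtain ⟨r, deg', d, hd, hrange, hker⟩ := exists_minimal_presentation S.graded
  exact ⟨⟨r, deg', LinearMap.ker d, hd.isGradedSub_ker, hker⟩, d, hd, hrange, rfl⟩

/-- The syzygies of a minimal system of homogeneous generators. -/
def GradedSub.next [Finite σ] (S : GradedSub σ K) : GradedSub σ K := S.exists_next.choose

/-- The presentation of a graded submodule by a minimal system of homogeneous generators. -/
def GradedSub.map [Finite σ] (S : GradedSub σ K) :
    (Fin S.next.rank → MvPolynomial σ K) →ₗ[MvPolynomial σ K] (Fin S.rank → MvPolynomial σ K) :=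
  S.exists_next.choose_spec.choose

lemma GradedSub.map_spec [Finite σ] (S : GradedSub σ K) :
    IsHomogMap S.next.deg S.deg S.map ∧ LinearMap.range S.map = S.sub ∧
      LinearMap.ker S.map = S.next.sub :=
  S.exists_next.choose_spec.choose_spec

end Graded

/-! ### Existence of minimal graded free resolutions -/

section Existence

open MvPolynomial

variable {K : Type*} [Field K] {n : ℕ}

/-- A homogeneous ideal without constant terms has a minimal graded free resolution. -/
lemma nonempty_minimalGradedFreeResolution {I : Ideal (MvPolynomial (Fin n) K)}
    (hI : ∀ f ∈ I, ∀ j, homogeneousComponent j f ∈ I) (hm : ∀ f ∈ I, constantCoeff f = 0) :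
    Nonempty (MinimalGradedFreeResolution I) := by
  let S₀ : GradedSub (Fin n) K :=
    { rank := 1
      deg := fun _ => 0
      sub := Submodule.comap (LinearMap.proj (0 : Fin 1)) I
      graded := by
        intro v hv j
        have : homogComp (fun _ => 0) j v (0 : Fin 1) = homogeneousComponent j (v 0) := by
          ext s
          rw [coeff_homogComp, coeff_homogeneousComponent, add_zero]
        rw [Submodule.mem_comap, LinearMap.proj_apply, this]
        exact hI _ hv j
      minimal := by
        intro v hv l
        rw [Subsingleton.elim l 0]
        exact hm _ hv }
  let S : ℕ → GradedSub (Fin n) K := fun i => Nat.rec S₀ (fun _ T => T.next) i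
  have hspec : ∀ i, IsHomogMap (S (i + 1)).deg (S i).deg (S i).map ∧
      LinearMap.range (S i).map = (S i).sub ∧ LinearMap.ker (S i).map = (S (i + 1)).sub :=
    fun i => (S i).map_spec
  refine ⟨{
    rank := fun i => (S i).rank
    deg := fun i => (S i).deg
    d := fun i => (S i).map
    aug := I.mkQ ∘ₗ LinearMap.proj (0 : Fin 1)
    d_homogeneous := fun i k l s hs => (hspec i).1 k l s hs
    aug_homogeneous := ?_
    exact := ?_
    exact_aug := ?_
    aug_surjective := ?_
    minimal := ?_ }⟩
  · intro k
    refine ⟨1, isHomogeneous_one _ _, ?_⟩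
    rw [Subsingleton.elim (α := Fin 1) k 0]
    rfl
  · intro i
    rw [LinearMap.exact_iff]
    exact (hspec i).2.2.trans (hspec (i + 1)).2.1.symm
  · rw [LinearMap.exact_iff]
    refine Eq.trans ?_ (hspec 0).2.1.symm
    rw [LinearMap.ker_comp, Submodule.ker_mkQ]
    rfl
  · intro y
    obtain ⟨x, rfl⟩ := Submodule.mkQ_surjective I y
    exact ⟨fun _ => x, rfl⟩
  · intro i k l
    refine (S i).minimal _ ?_ l
    rw [← (hspec i).2.1]
    exact LinearMap.mem_range_self _ _

end Existence

/-! ### The first graded Betti numbers of a monomial ideal -/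

section Betti

open MvPolynomial

variable {K : Type*} [Field K] {n : ℕ} {I : Ideal (MvPolynomial (Fin n) K)}

namespace MinimalGradedFreeResolution

variable (P : MinimalGradedFreeResolution I)

lemma isHomogMap_d (i : ℕ) : IsHomogMap (P.deg (i + 1)) (P.deg i) (P.d i) :=
  P.d_homogeneous i

lemma betti_ne_zero_iff {i j : ℕ} : P.betti i j ≠ 0 ↔ ∃ k, P.deg i k = j := by
  rw [betti, Finset.card_ne_zero]
  constructor
  · rintro ⟨k, hk⟩
    exact ⟨k, (Finset.mem_filter.mp hk).2⟩
  · rintro ⟨k, hk⟩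
    exact ⟨k, Finset.mem_filter.mpr ⟨Finset.mem_univ k, hk⟩⟩

lemma constantCoeff_d (i : ℕ) (z : Fin (P.rank (i + 1)) → MvPolynomial (Fin n) K)
    (l : Fin (P.rank i)) : constantCoeff (P.d i z l) = 0 := by
  rw [map_eq_sum_smul, Finset.sum_apply, map_sum]
  refine Finset.sum_eq_zero fun k _ => ?_
  rw [Pi.smul_apply, smul_eq_mul, map_mul, P.minimal, mul_zero]

/-- By exactness a basis vector in the kernel would lie in the image of the next differential, where
all constant terms vanish. -/
lemma d_single_ne_zero (i : ℕ) (k : Fin (P.rank (i + 1))) : P.d i (Pi.single k 1) ≠ 0 := by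
  intro h
  obtain ⟨y, hy⟩ := (P.exact i _).mp h
  have := P.constantCoeff_d (i + 1) y k
  rw [hy, Pi.single_eq_same, map_one] at this
  exact one_ne_zero this

lemma exists_deg_le {i j : ℕ} {z : Fin (P.rank (i + 1)) → MvPolynomial (Fin n) K}
    (h0 : P.d i z ≠ 0) (hz : IsHomogVec (P.deg i) j (P.d i z)) : ∃ k, P.deg (i + 1) k ≤ j := by
  by_contra! h
  refine h0 ?_
  rw [← hz.homogComp_eq, ← (P.isHomogMap_d i).map_homogComp]
  have : homogComp (P.deg (i + 1)) j z = 0 := by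
    ext1 k
    exact (isHomogVec_homogComp _ _ z).eq_zero_of_lt (h k)
  rw [this, map_zero]

/-- The first module of the resolution is free of rank one, generated in degree zero. -/
lemma exists_rank_zero (hI : ∀ f ∈ I, constantCoeff f = 0) :
    ∃ k₀ : Fin (P.rank 0), (∀ k, k = k₀) ∧ P.deg 0 k₀ = 0 ∧ ∀ v, P.aug v = 0 ↔ v k₀ ∈ I := by
  choose p hp haug using P.aug_homogeneous
  have haug' : ∀ v, P.aug v = Ideal.Quotient.mk I (∑ k, v k * p k) := by
    intro v
    rw [map_eq_sum_smul, map_sum]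
    refine Finset.sum_congr rfl fun k _ => ?_
    rw [haug, map_mul]
    rfl
  have hconst : ∀ k, constantCoeff (p k) ≠ 0 →
      P.deg 0 k = 0 ∧ p k = C (constantCoeff (p k)) := by
    intro k hk
    have h0 : P.deg 0 k = 0 := by
      by_contra h
      rw [constantCoeff_eq] at hk
      refine hk ((hp k).coeff_eq_zero ?_)
      simpa using Ne.symm h
    refine ⟨h0, ?_⟩
    have := (hp k).totalDegree_le
    rw [h0, Nat.le_zero] at this
    rw [constantCoeff_eq]
    exact totalDegree_eq_zero_iff_eq_C.mp this
  obtain ⟨v, hv⟩ := P.aug_surjective (Ideal.Quotient.mk I 1)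
  rw [haug', Ideal.Quotient.eq] at hv
  have hv' := hI _ hv
  rw [map_sub, map_one, map_sum, sub_eq_zero] at hv'
  obtain ⟨k₀, -, hk₀⟩ := Finset.exists_ne_zero_of_sum_ne_zero (hv'.trans_ne one_ne_zero)
  rw [map_mul] at hk₀
  have hc := right_ne_zero_of_mul hk₀
  obtain ⟨hdeg, hpc⟩ := hconst k₀ hc
  have huniq : ∀ k, k = k₀ := by
    intro k
    by_contra hk
    set c := constantCoeff (p k₀) with hcdef
    -- An element of the kernel of `aug` with coordinate `1` at `k`, which minimality forbids.
    set y : Fin (P.rank 0) → MvPolynomial (Fin n) K :=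
      Pi.single k 1 - (C c⁻¹ * p k) • Pi.single k₀ 1 with hy
    have hker : P.aug y = 0 := by
      rw [hy, map_sub, map_smul, haug, haug, hpc]
      change Ideal.Quotient.mk I (p k) - Ideal.Quotient.mk I (C c⁻¹ * p k * C c) = 0
      rw [← map_sub, mul_right_comm, ← C_mul, inv_mul_cancel₀ hc, C_1, one_mul, sub_self, map_zero]
    obtain ⟨x, hx⟩ := (P.exact_aug y).mp hker
    have := P.constantCoeff_d 0 x k
    rw [hx, hy] at this
    simp [hk] at this
  refine ⟨k₀, huniq, hdeg, fun v => ?_⟩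
  have hsum : ∑ k, v k * p k = v k₀ * C (constantCoeff (p k₀)) := by
    rw [Finset.sum_eq_single k₀ (fun k _ hk => (hk (huniq k)).elim) (by simp), ← hpc]
  rw [haug', hsum, Ideal.Quotient.eq_zero_iff_mem]
  refine ⟨fun h => ?_, fun h => Ideal.mul_mem_right _ _ h⟩
  have := Ideal.mul_mem_right (C (constantCoeff (p k₀))⁻¹) I h
  rwa [mul_assoc, ← C_mul, mul_inv_cancel₀ hc, C_1, mul_one] at this

end MinimalGradedFreeResolution

lemma isHomogVec_const_monomial {ι : Type*} {deg : ι → ℕ} (hdeg : ∀ k, deg k = 0)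
    (s : Fin n →₀ ℕ) : IsHomogVec deg s.degree fun _ => monomial s (1 : K) := by
  classical
  intro l t ht
  rw [mem_support_iff, coeff_monomial] at ht
  have : s = t := by
    by_contra h
    exact ht (if_neg h)
  rw [hdeg, this, add_zero]

lemma const_monomial_ne_zero {ι : Type*} (k : ι) (s : Fin n →₀ ℕ) :
    (fun _ : ι => monomial s (1 : K)) ≠ 0 := by
  intro h
  simpa using congrFun h k

/-- The least degree of a minimal generator. -/
lemma isLeast_betti_one (P : MinimalGradedFreeResolution I) (hI : ∀ f ∈ I, constantCoeff f = 0)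
    {d : ℕ} (hd : ∀ f ∈ I, ∀ s ∈ f.support, d ≤ s.degree) {s : Fin n →₀ ℕ}
    (hs : monomial s (1 : K) ∈ I) (hsd : s.degree = d) : IsLeast {j | P.betti 1 j ≠ 0} d := by
  obtain ⟨k₀, huniq, hdeg, hker⟩ := P.exists_rank_zero hI
  have hdeg' : ∀ k, P.deg 0 k = 0 := fun k => huniq k ▸ hdeg
  have hlow : ∀ k, d ≤ P.deg 1 k := by
    intro k
    have hne : P.d 0 (Pi.single k 1) k₀ ≠ 0 := by
      intro h
      refine P.d_single_ne_zero 0 k (funext fun l => ?_)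
      rw [huniq l, h]
      rfl
    have hmem := (hker _).mp ((P.exact_aug _).mpr ⟨Pi.single k 1, rfl⟩)
    obtain ⟨t, ht⟩ := support_nonempty.mpr hne
    have h1 := hd _ hmem t ht
    have h2 := P.d_homogeneous 0 k k₀ t ht
    rw [hdeg] at h2
    exact h1.trans h2.le
  constructor
  · obtain ⟨z, hz⟩ := (P.exact_aug (fun _ => monomial s 1)).mp ((hker _).mpr hs)
    have hv := isHomogVec_const_monomial (K := K) hdeg' s
    rw [← hz, hsd] at hv
    obtain ⟨k, hk⟩ := P.exists_deg_le (hz ▸ const_monomial_ne_zero k₀ s) hv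
    exact P.betti_ne_zero_iff.mpr ⟨k, le_antisymm hk (hlow k)⟩
  · intro j hj
    obtain ⟨k, rfl⟩ := P.betti_ne_zero_iff.mp hj
    exact hlow k

/-- A term `u + e a` can cancel only against one coming from some `b ≠ a`. It would then be
divisible by the lcm of both generators, whose degree exceeds `j`. -/
lemma sum_smul_eq_zero_of_degree_lt {α ι : Type*} [Fintype α] (k₀ : ι) {e : α → Fin n →₀ ℕ}
    {d j : ℕ} (hd : ∀ a b, a ≠ b → d ≤ (e a ⊔ e b).degree) (hj : j < d)
    {y : α → MvPolynomial (Fin n) K} (hy : IsHomogVec (fun a => (e a).degree) j y)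
    (h0 : ∑ a, y a • (fun _ : ι => monomial (e a) (1 : K)) = 0) : y = 0 := by
  classical
  ext a u
  rw [Pi.zero_apply, coeff_zero]
  by_cases hu : u.degree + (e a).degree = j
  · have h1 := congrArg (coeff (u + e a)) (congrFun h0 k₀)
    rw [Finset.sum_apply, coeff_sum, Finset.sum_eq_single a] at h1
    · simpa using h1
    · intro b _ hba
      rw [Pi.smul_apply, smul_eq_mul, coeff_mul_monomial', if_neg]
      intro hle
      have h2 : e a ⊔ e b ≤ u + e a := sup_le le_add_self hle
      have h3 := Finsupp.degree_mono h2
      rw [map_add] at h3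
      have := hd a b hba.symm
      omega
    · simp
  · exact hy.coeff_eq_zero hu

/-- If the least common multiples of two minimal monomial generators have degree at least `d`,
with equality for some pair, then `d` is the least degree of a minimal syzygy. -/
lemma isLeast_betti_two (P : MinimalGradedFreeResolution I) (hI : ∀ f ∈ I, constantCoeff f = 0)
    {α : Type*} [Fintype α] {e : α → Fin n →₀ ℕ}
    (hIe : I = Ideal.span (Set.range fun a => monomial (e a) (1 : K)))
    (hanti : ∀ a b, e a ≤ e b → a = b) {d : ℕ} (hd : ∀ a b, a ≠ b → d ≤ (e a ⊔ e b).degree)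
    {a₀ b₀ : α} (hne : a₀ ≠ b₀) (hd₀ : (e a₀ ⊔ e b₀).degree = d) :
    IsLeast {j | P.betti 2 j ≠ 0} d := by
  classical
  obtain ⟨k₀, huniq, hdeg, hker⟩ := P.exists_rank_zero hI
  have hdeg' : ∀ k, P.deg 0 k = 0 := fun k => huniq k ▸ hdeg
  have hmono : ∀ a, monomial (e a) (1 : K) ∈ I := fun a => by
    rw [hIe]
    exact Ideal.subset_span ⟨a, rfl⟩
  have hdvd : ∀ f ∈ I, ∀ v ∈ f.support, ∃ a, e a ≤ v := by
    intro f hf v hv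
    have himg : (Set.range fun a => monomial (e a) (1 : K)) =
        (fun s => monomial s 1) '' Set.range e := by
      rw [← Set.range_comp]
      rfl
    rw [hIe, himg, mem_ideal_span_monomial_image] at hf
    obtain ⟨_, ⟨a, rfl⟩, ha⟩ := hf v hv
    exact ⟨a, ha⟩
  have hr : ∀ a, ∃ r, P.d 0 r = (fun _ => monomial (e a) (1 : K)) ∧
      IsHomogVec (P.deg 1) (e a).degree r := by
    intro a
    obtain ⟨z, hz⟩ := (P.exact_aug (fun _ => monomial (e a) 1)).mp ((hker _).mpr (hmono a))
    refine ⟨homogComp (P.deg 1) (e a).degree z, ?_, isHomogVec_homogComp _ _ _⟩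
    rw [(P.isHomogMap_d 0).map_homogComp, hz]
    exact (isHomogVec_const_monomial hdeg' (e a)).homogComp_eq
  choose r hr hrhom using hr
  let M : α → Fin (P.rank 0) → MvPolynomial (Fin n) K := fun a _ => monomial (e a) 1
  have hM : IsHomogMap (fun a => (e a).degree) (P.deg 0)
      (Fintype.linearCombination (MvPolynomial (Fin n) K) M) :=
    isHomogMap_linearCombination fun a => isHomogVec_const_monomial hdeg' (e a)
  have hT : ∀ k, ∃ y : α → MvPolynomial (Fin n) K,
      IsHomogVec (fun a => (e a).degree) (P.deg 1 k) y ∧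
        ∑ a, y a • M a = P.d 0 (Pi.single k 1) := by
    intro k
    have hmem := (hker _).mp ((P.exact_aug _).mpr ⟨Pi.single k 1, rfl⟩)
    have hmem' : P.d 0 (Pi.single k 1) k₀ ∈
        Submodule.span (MvPolynomial (Fin n) K) (Set.range fun a => monomial (e a) (1 : K)) :=
      hIe.le hmem
    obtain ⟨y, hy⟩ := (Submodule.mem_span_range_iff_exists_fun _).mp hmem'
    refine ⟨homogComp _ (P.deg 1 k) y, isHomogVec_homogComp _ _ _, ?_⟩
    have hlin : Fintype.linearCombination (MvPolynomial (Fin n) K) M y =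
        P.d 0 (Pi.single k 1) := by
      rw [Fintype.linearCombination_apply]
      ext1 l
      rw [huniq l, Finset.sum_apply, ← hy]
      rfl
    have := hM.map_homogComp (P.deg 1 k) y
    rw [hlin, (P.isHomogMap_d 0 k).homogComp_eq] at this
    rw [← this, Fintype.linearCombination_apply]
  choose T hThom hT using hT
  -- The basis of `F_1` is not identified with the monomial generators; `T` and `r` compare the two,
  -- and `η` is the defect of their composite from the identity, which consists of syzygies.
  let η : Fin (P.rank 1) → Fin (P.rank 1) → MvPolynomial (Fin n) K :=
    fun k => Pi.single k 1 - ∑ a, T k a • r a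
  have hη : ∀ k, P.d 0 (η k) = 0 := by
    intro k
    simp only [η, map_sub, map_sum, map_smul, hr]
    rw [← hT k]
    exact sub_self _
  have hηhom : ∀ k, IsHomogVec (P.deg 1) (P.deg 1 k) (η k) := fun k =>
    (isHomogVec_single _ k).sub ((hThom k).sum_smul hrhom)
  have hzero : ∀ j, j < d → ∀ z, IsHomogVec (P.deg 1) j z → P.d 0 z = 0 → z = 0 := by
    intro j
    induction j using Nat.strong_induction_on with
    | _ j ih =>
      intro hj z hz hz0
      -- Transported to the monomial generators, `z` vanishes, so `z` is a combination of the `η k`.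
      -- Those of degree below `j` vanish by induction; the other coefficients vanish by minimality
      -- or for degree reasons.
      have hy : ∑ k, z k • T k = 0 := by
        refine sum_smul_eq_zero_of_degree_lt k₀ hd hj (hz.sum_smul hThom) ?_
        have : ∑ a, (∑ k, z k • T k) a • M a = ∑ k, z k • ∑ a, T k a • M a := by
          simp only [Finset.sum_apply, Pi.smul_apply, Finset.sum_smul, Finset.smul_sum, smul_smul,
            smul_eq_mul]
          exact Finset.sum_comm
        refine this.trans ?_
        simp only [hT]
        rw [← map_eq_sum_smul, hz0]
      have hy' : ∑ k, z k • ∑ a, T k a • r a = 0 := by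
        have : ∑ k, z k • ∑ a, T k a • r a = ∑ a, (∑ k, z k • T k) a • r a := by
          simp only [Finset.sum_apply, Pi.smul_apply, Finset.sum_smul, Finset.smul_sum, smul_smul,
            smul_eq_mul]
          exact Finset.sum_comm
        rw [this, hy]
        simp
      have hzη : z = ∑ k, z k • η k := by
        simp only [η, smul_sub, Finset.sum_sub_distrib, hy', sub_zero]
        exact map_eq_sum_smul LinearMap.id z
      rw [hzη]
      refine Finset.sum_eq_zero fun k _ => ?_
      rcases lt_trichotomy (P.deg 1 k) j with hk | hk | hk
      · rw [ih _ hk (hk.trans hj) (η k) (hηhom k) (hη k), smul_zero]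
      · have : z k = 0 := by
          obtain ⟨x, hx⟩ := (P.exact 0 z).mp hz0
          have hc := P.constantCoeff_d 1 x k
          rw [hx] at hc
          ext s
          rw [coeff_zero]
          by_cases hs : s = 0
          · rw [hs]
            exact hc
          · refine hz.coeff_eq_zero ?_
            have : s.degree ≠ 0 := by simpa [Finsupp.degree_eq_zero_iff] using hs
            omega
        rw [this, zero_smul]
      · rw [hz.eq_zero_of_lt hk, zero_smul]
  have hlow : ∀ k, d ≤ P.deg 2 k := by
    intro k
    by_contra! hk
    exact P.d_single_ne_zero 1 k (hzero _ hk _ (P.isHomogMap_d 1 k)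
      ((P.exact 0 _).mpr ⟨_, rfl⟩))
  constructor
  · set p := e a₀ ⊔ e b₀ - e a₀ with hp
    set q := e a₀ ⊔ e b₀ - e b₀ with hq
    have hpa : p + e a₀ = e a₀ ⊔ e b₀ := tsub_add_cancel_of_le le_sup_left
    have hqb : q + e b₀ = e a₀ ⊔ e b₀ := tsub_add_cancel_of_le le_sup_right
    set z := monomial p (1 : K) • r a₀ - monomial q (1 : K) • r b₀ with hz
    have hzker : P.d 0 z = 0 := by
      rw [hz, map_sub, map_smul, map_smul, hr, hr]
      ext1 l
      rw [Pi.sub_apply, Pi.smul_apply, Pi.smul_apply, smul_eq_mul, smul_eq_mul, monomial_mul,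
        monomial_mul, hpa, hqb, sub_self]
      rfl
    have hzhom : IsHomogVec (P.deg 1) d z := by
      have h1 := (hrhom a₀).monomial_smul p
      have h2 := (hrhom b₀).monomial_smul q
      rw [← map_add, hpa, hd₀] at h1
      rw [← map_add, hqb, hd₀] at h2
      exact h1.sub h2
    -- If `z = 0`, then `q` divides every coefficient of `r a₀`, as `p` and `q` are coprime. Writing
    -- `e a₀ = u + v` with `q ≤ u`, a generator dividing `v` divides both `e a₀` and `e b₀`, against
    -- the antichain property.
    have hz0 : z ≠ 0 := by
      intro h
      have hdiv : ∀ k, ∀ u ∈ (r a₀ k).support, q ≤ u := by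
        intro k u hu
        have h1 := congrArg (coeff (p + u)) (congrFun (sub_eq_zero.mp h) k)
        rw [Pi.smul_apply, Pi.smul_apply, smul_eq_mul, smul_eq_mul, coeff_monomial_mul,
          one_mul, coeff_monomial_mul'] at h1
        split_ifs at h1 with hle
        · intro i
          have h2 := hle i
          simp only [hp, hq, Finsupp.add_apply, Finsupp.tsub_apply, Finsupp.sup_apply] at h2 ⊢
          rcases le_total (e a₀ i) (e b₀ i) with h3 | h3
          · rw [sup_eq_right.mpr h3]
            omega
          · rw [sup_eq_left.mpr h3] at h2 ⊢
            omega
        · exact (mem_support_iff.mp hu h1).elim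
      have h1 := congrArg (coeff (e a₀)) (congrFun (hr a₀) k₀)
      rw [map_eq_sum_smul, Finset.sum_apply, coeff_sum, coeff_monomial, if_pos rfl] at h1
      obtain ⟨k, -, hk⟩ := Finset.exists_ne_zero_of_sum_ne_zero (h1.trans_ne one_ne_zero)
      rw [Pi.smul_apply, smul_eq_mul] at hk
      obtain ⟨u, hu, v, hv, huv⟩ :=
        Finset.mem_add.mp (support_mul _ _ (mem_support_iff.mpr hk))
      have hmem := (hker _).mp ((P.exact_aug _).mpr ⟨Pi.single k 1, rfl⟩)
      obtain ⟨c, hc⟩ := hdvd _ hmem v hv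
      have hqu := hdiv k u hu
      have hca : c = a₀ := hanti _ _ (hc.trans (huv ▸ le_add_self))
      have hcb : c = b₀ := by
        refine hanti _ _ (hc.trans fun i => ?_)
        have h2 := hqu i
        have h3 := DFunLike.congr_fun huv i
        simp only [hq, Finsupp.add_apply, Finsupp.tsub_apply, Finsupp.sup_apply] at h2 h3
        have h4 : e a₀ i ≤ e a₀ i ⊔ e b₀ i := le_sup_left
        omega
      exact hne (hca.symm.trans hcb)
    obtain ⟨x, hx⟩ := (P.exact 0 z).mp hzker
    rw [← hx] at hz0 hzhom
    obtain ⟨k, hk⟩ := P.exists_deg_le hz0 hzhom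
    exact P.betti_ne_zero_iff.mpr ⟨k, le_antisymm hk (hlow k)⟩
  · intro j hj
    obtain ⟨k, rfl⟩ := P.betti_ne_zero_iff.mp hj
    exact hlow k

end Betti

/-! ### The ideal of the supports of a set of codewords -/

section SupportIdeal

open MvPolynomial

variable {n : ℕ}

/-- The exponent vector of the square-free monomial with support `S`. -/
def setExpo (S : Finset (Fin n)) : Fin n →₀ ℕ := ∑ i ∈ S, Finsupp.single i 1

lemma setExpo_apply (S : Finset (Fin n)) (i : Fin n) :
    setExpo S i = if i ∈ S then 1 else 0 := by
  simp [setExpo, Finsupp.finsetSum_apply, Finsupp.single_apply]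

@[simp]
lemma degree_setExpo (S : Finset (Fin n)) : (setExpo S).degree = S.card := by
  simp [setExpo]

lemma setExpo_sup (S T : Finset (Fin n)) : setExpo S ⊔ setExpo T = setExpo (S ∪ T) := by
  ext i
  rw [Finsupp.sup_apply, setExpo_apply, setExpo_apply, setExpo_apply]
  by_cases h : i ∈ S <;> by_cases h' : i ∈ T <;> simp [h, h']

lemma setExpo_le_iff {S T : Finset (Fin n)} : setExpo S ≤ setExpo T ↔ S ⊆ T := by
  constructor
  · intro h i hi
    by_contra hiT
    have := h i
    simp [setExpo_apply, hi, hiT] at this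
  · intro h i
    rw [setExpo_apply, setExpo_apply]
    by_cases hi : i ∈ S
    · simp [hi, h hi]
    · simp [hi]

lemma prod_X_eq_monomial (K : Type*) [Field K] (S : Finset (Fin n)) :
    ∏ i ∈ S, (X i : MvPolynomial (Fin n) K) = monomial (setExpo S) 1 := by
  rw [setExpo, monomial_sum_one]
  rfl

variable {F : Type*} [Field F] (K : Type*) [Field K] (M : Set (Fin n → F))

/-- The set of supports of the words in `M`. -/
abbrev Supports : Type := {S : Finset (Fin n) // ∃ c ∈ M, supp c = S}

lemma supportIdeal_eq_span :
    supportIdeal K M =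
      Ideal.span (Set.range fun S : Supports M => monomial (setExpo S.1) (1 : K)) := by
  rw [supportIdeal]
  congr 1
  ext t
  constructor
  · rintro ⟨c, hc, rfl⟩
    exact ⟨⟨supp c, c, hc, rfl⟩, (prod_X_eq_monomial K _).symm⟩
  · rintro ⟨⟨_, c, hc, rfl⟩, rfl⟩
    exact ⟨c, hc, (prod_X_eq_monomial K _).symm⟩

variable {K M}

lemma mem_supportIdeal_iff {f : MvPolynomial (Fin n) K} :
    f ∈ supportIdeal K M ↔ ∀ s ∈ f.support, ∃ c ∈ M, setExpo (supp c) ≤ s := by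
  have himg : (Set.range fun S : Supports M => monomial (setExpo S.1) (1 : K)) =
      (fun s => monomial s 1) '' Set.range fun S : Supports M => setExpo S.1 := by
    rw [← Set.range_comp]
    rfl
  rw [supportIdeal_eq_span, himg, mem_ideal_span_monomial_image]
  refine forall₂_congr fun s _ => ?_
  constructor
  · rintro ⟨_, ⟨⟨_, c, hc, rfl⟩, rfl⟩, h⟩
    exact ⟨c, hc, h⟩
  · rintro ⟨c, hc, h⟩
    exact ⟨_, ⟨⟨supp c, c, hc, rfl⟩, rfl⟩, h⟩

lemma homogeneousComponent_mem_supportIdeal {f : MvPolynomial (Fin n) K}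
    (hf : f ∈ supportIdeal K M) (j : ℕ) : homogeneousComponent j f ∈ supportIdeal K M := by
  rw [mem_supportIdeal_iff] at hf ⊢
  intro s hs
  rw [support_homogeneousComponent] at hs
  exact hf s (Finset.mem_filter.mp hs).1

lemma constantCoeff_eq_zero_of_mem_supportIdeal (h0 : ∀ c ∈ M, c ≠ 0)
    {f : MvPolynomial (Fin n) K} (hf : f ∈ supportIdeal K M) : constantCoeff f = 0 := by
  by_contra h
  obtain ⟨c, hc, hle⟩ := mem_supportIdeal_iff.mp hf 0 (mem_support_iff.mpr h)
  have := Finsupp.degree_mono hle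
  rw [degree_setExpo, map_zero] at this
  have := (supp_nonempty (h0 c hc)).card_pos
  omega

end SupportIdeal

end

end LinearCodeBetti

/-! ### Attaining the first two generalized Hamming weights by generators -/

theorem corollary6p3 {F K : Type*} [Field F] [Finite F] [Field K] {n : ℕ}
    (C : Submodule F (Fin n → F)) (hC : 1 ≤ Module.finrank F C)
    (ord : MonomialOrder (Fin n × Fˣ))
    (hdeg : DegreeCompatible ord) (hblock : BlockDecreasing ord)
    (G : Set (MvPolynomial (Fin n × Fˣ) K))
    (hG : IsReducedGroebnerBasis ord (codeIdeal K C) G) :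
    Nonempty (MinimalGradedFreeResolution (supportIdeal K (groebnerWords ord C G))) ∧
    ∀ P : MinimalGradedFreeResolution (supportIdeal K (groebnerWords ord C G)),
      IsLeast {j | P.betti 1 j ≠ 0} (ghw C 1) ∧
      (2 ≤ Module.finrank F C → NegCompatible ord →
        ∀ m₁ m₂ : Fin n → F, IsLeastWord ord (firstWords C) m₁ →
          IsLeastWord ord (secondWords C m₁) m₂ →
          ((supp m₁ ∩ supp m₂).card : ℚ) ≤ ((supp m₂).card + 1) / 2 →
          IsLeast {j | P.betti 2 j ≠ 0} (ghw C 2)) := by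
  classical
  set M := groebnerWords ord C G
  have hmemC : ∀ c ∈ M, c ∈ C := fun c hc => hc.1.1
  have hne0 : ∀ c ∈ M, c ≠ 0 := fun c hc => hc.2.2.1
  have hconst : ∀ f ∈ supportIdeal K M, MvPolynomial.constantCoeff f = 0 :=
    fun f hf => constantCoeff_eq_zero_of_mem_supportIdeal hne0 hf
  refine ⟨nonempty_minimalGradedFreeResolution
    (fun f hf j => homogeneousComponent_mem_supportIdeal hf j) hconst, fun P => ⟨?_, ?_⟩⟩
  · obtain ⟨c, hc, hcw⟩ := exists_mem_groebnerWords_card_eq_ghw_one hC hdeg hG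
    refine isLeast_betti_one P hconst ?_ (s := setExpo (supp c)) ?_ (by rw [degree_setExpo, hcw])
    · intro f hf s hs
      obtain ⟨c', hc', hle⟩ := mem_supportIdeal_iff.mp hf s hs
      have h1 := Finsupp.degree_mono hle
      rw [degree_setExpo] at h1
      exact (ghw_one_le (hmemC c' hc') (hne0 c' hc')).trans h1
    · rw [← prod_X_eq_monomial]
      exact Ideal.subset_span ⟨c, hc, rfl⟩
  intro hC2 hneg m₁ m₂ h₁ h₂ hcard
  obtain ⟨⟨hm₁, hm₁0, -⟩, hleast₁⟩ := h₁
  obtain ⟨⟨hm₂, hw₂⟩, hleast₂⟩ := h₂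
  rw [suppSub_span_pair] at hw₂
  have hfirst : ∀ x ∈ C, x ≠ 0 → ∀ y ∈ C, (supp x ∪ supp y).card = ghw C 2 →
      expo m₁ ≼[ord] expo x := fun x hx hx0 y hy hxy =>
    hleast₁ x ⟨hx, hx0, y, hy, by rw [suppSub_span_pair, hxy]⟩
  have hsecond : ∀ x ∈ C, (supp m₁ ∪ supp x).card = ghw C 2 → expo m₂ ≼[ord] expo x :=
    fun x hx hxy => hleast₂ x ⟨hx, by rw [suppSub_span_pair, hxy]⟩
  have hkill : ∀ x y : Fin n → F, x ∈ C → y ∈ C → x ≠ 0 → (supp x ∪ supp y).card = ghw C 2 →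
      ∃ t : F, (supp (y - t • x)).card < ghw C 2 ∧ supp x ∪ supp (y - t • x) = supp x ∪ supp y := by
    intro x y hx hy hx0 hxy
    obtain ⟨i, hi⟩ := supp_nonempty hx0
    have hi' := mem_supp.mp hi
    -- This multiple of `x` cancels coordinate `i` of `y` and alters `y` only inside `supp x`.
    refine ⟨y i / x i, ?_, ?_⟩
    · rw [← hxy]
      refine Finset.card_lt_card ((Finset.ssubset_iff_of_subset ?_).mpr
        ⟨i, Finset.mem_union_left _ hi, ?_⟩)
      · refine (supp_sub_subset _ _).trans ?_
        rw [Finset.union_comm]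
        exact Finset.union_subset_union_left (supp_smul_subset _ _)
      · simp [hi']
    · ext j
      by_cases hj : x j = 0 <;> simp [hj]
  have hlt₁ : (supp m₁).card < ghw C 2 := by
    obtain ⟨x, hx, y, hy, hx0, hxy, hw⟩ := exists_card_supp_eq_ghw_two hC2
    obtain ⟨t, ht, hu⟩ := hkill x y hx hy hx0 hw
    refine (card_le_of_expo_le hdeg (hfirst (y - t • x) (C.sub_mem hy (C.smul_mem t hx)) ?_ x hx
      (by rw [Finset.union_comm, hu, hw]))).trans_lt ht
    intro h
    exact hxy t (sub_eq_zero.mp h).symm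
  have hlt₂ : (supp m₂).card < ghw C 2 := by
    obtain ⟨t, ht, hu⟩ := hkill m₁ m₂ hm₁ hm₂ hm₁0 hw₂.symm
    exact (card_le_of_expo_le hdeg (hsecond _ (C.sub_mem hm₂ (C.smul_mem t hm₁))
      (by rw [hu, ← hw₂]))).trans_lt ht
  have hle₁₂ : (supp m₁).card ≤ (supp m₂).card := by
    refine card_le_of_expo_le hdeg (hfirst m₂ hm₂ ?_ m₁ hm₁ (by rw [Finset.union_comm, ← hw₂]))
    rintro rfl
    rw [supp_zero, Finset.union_empty] at hw₂
    omega
  have hcard' : 2 * (supp m₁ ∩ supp m₂).card ≤ (supp m₂).card + 1 := by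
    rw [le_div_iff₀ (by norm_num)] at hcard
    have : ((2 * (supp m₁ ∩ supp m₂).card : ℕ) : ℚ) ≤ (((supp m₂).card + 1 : ℕ) : ℚ) := by
      push_cast
      linarith
    exact_mod_cast this
  have hui := Finset.card_union_add_card_inter (supp m₁) (supp m₂)
  -- The final numerical condition holds because `d₂ = |I| + |J| - |I ∩ J| ≥ |I| + |J| / 2 ≥ |I| +
  -- |I| / 2`, with divisions rounded down.
  obtain ⟨c₁, hc₁, hs₁⟩ := exists_mem_groebnerWords_supp_eq hdeg hneg hG hm₁ hm₁0
    (fun x hx hxs hle => hfirst x hx (fun h => hxs (h ▸ Submodule.zero_mem _)) m₁ hm₁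
      (by
        rw [Finset.union_comm]
        exact le_antisymm hle (ghw_two_le_of_notMem_span hm₁ hx hm₁0 hxs)))
    hlt₁ (by omega)
  obtain ⟨c₂, hc₂, hs₂⟩ : ∃ c ∈ M, (supp m₁ ∪ supp c).card = ghw C 2 := by
    -- The intersection bound is exactly what allows `a` to contain `supp m₁ ∩ supp m₂`, leaving `b`
    -- disjoint from `supp m₁`.
    obtain ⟨a, b, hmab, hdis, hunion, hsub, hsum, hba, hab⟩ :=
      exists_balanced_split m₂ (Finset.inter_subset_right (s₁ := supp m₁)) hcard'
    refine exists_mem_groebnerWords_card_union_eq hdeg hG (x := a) (y := b) hm₁ hm₁0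
      (fun x hx hxs hle => card_le_of_expo_le hdeg (hsecond x hx
        (le_antisymm hle (ghw_two_le_of_notMem_span hm₁ hx hm₁0 hxs)))) hlt₂
      ⟨hmab ▸ hm₂, fun h => ?_, ?_, hsum, hba, hab⟩
    · rw [← hmab] at h
      rw [Finset.union_eq_left.mpr (supp_subset_of_mem_span h)] at hw₂
      omega
    · have hdis' : Disjoint (supp m₁ ∪ supp a) (supp b) := by
        refine Finset.disjoint_union_left.mpr ⟨?_, hdis⟩
        refine Finset.disjoint_left.mpr fun i hi hib => ?_
        exact Finset.disjoint_left.mp hdis (hsub (Finset.mem_inter.mpr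
          ⟨hi, hunion ▸ Finset.mem_union_right _ hib⟩)) hib
      rw [← Finset.card_union_of_disjoint hdis', Finset.union_assoc, hunion, hw₂]
  refine isLeast_betti_two P hconst (supportIdeal_eq_span K M) (fun S T h => ?_) ?_
    (a₀ := ⟨supp c₁, c₁, hc₁, rfl⟩) (b₀ := ⟨supp c₂, c₂, hc₂, rfl⟩) ?_ ?_
  · obtain ⟨⟨_, c, hc, rfl⟩, ⟨_, c', hc', rfl⟩⟩ := S, T
    by_contra hne
    exact hc'.2.2.2 c (hmemC c hc) (hne0 c hc)
      ((setExpo_le_iff.mp h).ssubset_of_ne fun h => hne (Subtype.ext h))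
  · rintro ⟨_, c, hc, rfl⟩ ⟨_, c', hc', rfl⟩ hne
    rw [setExpo_sup, degree_setExpo]
    refine ghw_two_le_of_notMem_span (hmemC c hc) (hmemC c' hc') (hne0 c hc) fun h => ?_
    exact hne (Subtype.ext (supp_eq_of_mem_span h (hne0 c' hc')).symm)
  · intro h
    have h' : supp c₁ = supp c₂ := congrArg Subtype.val h
    rw [← h', hs₁, Finset.union_self] at hs₂
    omega
  · rw [setExpo_sup, degree_setExpo]
    change (supp c₁ ∪ supp c₂).card = ghw C 2
    rw [hs₁, hs₂]
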